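/- Let $\mathbb F$ be a field and let $T\subseteq\mathbb R$ be an additive subgroup (for example $\mathbb Z$ or $\mathbb R$). A persistence module is a functor $V$ from the ordered set $T$ to $\mathbb F$-vector spaces that is pointwise finite dimensional and finitely indexed: for some finite $P\subseteq T$ it vanishes before $\min P$ and after $\max P$, it changes by births only at indices in $P$, and by deaths only immediately after indices in $P$. (For $T=\mathbb Z$ and $P=\{0,\dots,l\}$ these are the diagrams $V_0\to\dots\to V_l$, extended by zero.) Its barcode $\mathrm{Barc}(V)$ is the multiset of closed intervals $[a,b]$, with $a\le b$ in $T$, of its decomposition into interval modules $k_{[a,b]}$. The bar $J=[a,b]$ has length $|J|=b-a$. The nestedness $\Xi(V)\in(0,\infty]$ is the minimum of $\min\{|a-c|,|b-d|\}$ over all pairs of bars $[a,b],[c,d]$ of $V$ with $c<a$ and $b<d$ ($\infty$ if there are none). Put $V(\delta)_t=V_{t+\delta}$, and let $[\delta]\colon V\to V(\delta)$ be the inner morphisms. A $\delta$-interleaving pair is a pair of morphisms $\Phi\colon V\to W(\delta)$, $\Psi\colon W\to V(\delta)$ such that $\Psi(\delta)\circ\Phi$ and $\Phi(\delta)\circ\Psi$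 are the inner morphisms $[2\delta]$. For $q\ge0$, a $q$-splitting is an isomorphism $V\cong V_{\ge q}\oplus V_{<q}$ in which all bars of $V_{\ge q}$ have length $\ge q$ and all bars of $V_{<q}$ have length $<q$. Let $pr^V\colon V\to V_{\ge q}$ and $i^V\colon V_{\ge q}\to V$ be the projection and the inclusion, and put $\varphi^V=[\tfrac q2]\circ pr^V\colon V\to V_{\ge q}(\tfrac q2)$ and $\tilde\varphi^V=i^V(\tfrac q2)\circ[\tfrac q2]\colon V_{\ge q}\to V(\tfrac q2)$. A ladder decomposition of a morphism $X\to Y$ is an isomorphism, in the category of morphisms of persistence modules, with a finite direct sum of elementary morphisms: $\mathbf R^{I}_{J}\colon k_I\to k_J$, the identity of $\mathbb F$ on $I\cap J$, where $J=[j_1,j_2]$, $I=[i_1,i_2]$ and $j_1\le i_1\le j_2\le i_2$; $\mathbf I^+_I\colon k_I\to0$; and $\mathbf I^-_K\colon 0\to k_K$. A morphism $\Phi'\colon X\to Y(d)$ with a ladder decomposition induces the multiset $\chi_{\Phi'}$ of pairs of bars that contains each $(I,J)$ as often as $\mathbf R^{I}_{J(d)}$ occurs in the decomposition, where $J(d)=[j_1-d,j_2-d]$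 for $J=[j_1,j_2]$. A partial matching between multisets of bars $S_1,S_2$ is a multiset of pairs whose multisets of first and of second components are contained in $S_1$ and in $S_2$, respectively. Its cost is the maximum of the numbers $\max(|i_1-j_1|,|i_2-j_2|)$ for matched pairs $([i_1,i_2],[j_1,j_2])$ and of the numbers $|J|/2$ for unmatched bars $J$ of $S_1$ and $S_2$. **Corollary.** Let $(\Phi,\Psi)$ be a $\delta$-interleaving pair between persistence modules $V$ and $W$, where $\delta\in T$ and $\delta\ge0$. Let $q\ge0$ with $\tfrac q2\in T$, let $q$-splittings of $V$ and $W$ be given, and suppose that $$\delta<\tfrac12\min\bigl(\Xi(V_{\ge q}),\Xi(W_{\ge q})\bigr)-\tfrac q2 .$$ Then the following three pairs $(\Phi',\Psi')$ are $(\delta+\tfrac q2)$-interleaving pairs: 1. $\varphi^W(\delta)\circ\Phi\colon V\to W_{\ge q}(\delta+\tfrac q2)$ and $\Psi(\tfrac q2)\circ\tilde\varphi^W\colon W_{\ge q}\to V(\delta+\tfrac q2)$; 2. $\Phi(\tfrac q2)\circ\tilde\varphi^V\colon V_{\ge q}\to W(\delta+\tfrac q2)$ and $\varphi^V(\delta)\circ\Psi\colon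 W\to V_{\ge q}(\delta+\tfrac q2)$; 3. $\varphi^W(\delta)\circ\Phi\circ i^V\colon V_{\ge q}\to W_{\ge q}(\delta+\tfrac q2)$ and $\varphi^V(\delta)\circ\Psi\circ i^W\colon W_{\ge q}\to V_{\ge q}(\delta+\tfrac q2)$. Moreover, for the pair 3; for the pair 1 if in addition $\delta<\tfrac12\min(\Xi(V),\Xi(W_{\ge q}))-\tfrac q2$; and for the pair 2 if in addition $\delta<\tfrac12\min(\Xi(V_{\ge q}),\Xi(W))-\tfrac q2$, the following hold: * both $\Phi'$ and $\Psi'$ have ladder decompositions, and the multisets $\chi_{\Phi'}$ and $\chi_{\Psi'}$ do not depend on the choice of decomposition; * $\chi_{\Phi'}$ is a partial matching between $\mathrm{Barc}(V)$ and $\mathrm{Barc}(W)$, and $\chi_{\Psi'}$ is a partial matching between $\mathrm{Barc}(W)$ and $\mathrm{Barc}(V)$, both of cost at most $\delta+\tfrac q2$; * both matchings leave the bars of $W_{<q}$ unmatched in cases 1 and 3, and the bars of $V_{<q}$ unmatched in cases 2 and 3; * for all bars $J_V\in\mathrm{Barc}(V)$ and $J_W\in\mathrm{Barc}(W)$ of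 length at least $2\delta+q$, the multiplicity of $(J_V,J_W)$ in $\chi_{\Phi'}$ equals that of $(J_W,J_V)$ in $\chi_{\Psi'}$. -/

import Mathlib

open CategoryTheory CategoryTheory.Limits

namespace PersLadder

universe u

/-! ### Bars

The indices form an additive subgroup `T` of `ℝ`, for instance a copy of `ℤ`, or all of `ℝ`. -/

/-- A bar: a closed interval `[birth, death]` of indices. -/
@[ext] structure Bar (T : AddSubgroup ℝ) where
  birth : T
  death : T
  le : birth ≤ death

namespace Bar

variable {T : AddSubgroup ℝ}

noncomputable instance : DecidableEq (Bar T) := Classical.decEq _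

/-- The index `t` lies in the bar `J`. -/
def Mem (J : Bar T) (t : T) : Prop := J.birth ≤ t ∧ t ≤ J.death

/-- The length `b - a` of the bar `[a, b]`. -/
def length (J : Bar T) : ℝ := (J.death : ℝ) - (J.birth : ℝ)

/-- The relation `J ≼ I`: for `J = [i₁, j₁]` and `I = [i₂, j₂]` it means `i₁ ≤ i₂ ≤ j₁ ≤ j₂`. -/
def Overlaps (J I : Bar T) : Prop :=
  J.birth ≤ I.birth ∧ I.birth ≤ J.death ∧ J.death ≤ I.death

/-- `I` is strictly nested in `J`: both endpoints of `I` lie strictly inside `J`. -/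
def StrictlyNested (I J : Bar T) : Prop :=
  J.birth < I.birth ∧ I.death < J.death

/-- The bar `[a + d, b + d]`. If `J` is a bar of the shifted module `W(d)`, then this is the
corresponding bar of `W`. -/
def translate (J : Bar T) (d : T) : Bar T where
  birth := J.birth + d
  death := J.death + d
  le := add_le_add_left J.le d

end Bar

/-! ### Persistence modules -/

section Modules

/-- Persistence modules over the field `F`, indexed by `T`; morphisms are natural
transformations. -/
abbrev PersMod (F : Type u) [Field F] (T : AddSubgroup ℝ) := T ⥤ ModuleCat.{u} F

instance (F : Type u) [Field F] (T : AddSubgroup ℝ) : HasFiniteBiproducts (PersMod F T) :=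
  HasFiniteBiproducts.of_hasFiniteProducts

variable {F : Type u} [Field F] {T : AddSubgroup ℝ}

/-- The module is pointwise finite dimensional and determined by finitely many indices
`P = {p₀ < ⋯ < pₗ}`: it vanishes before `p₀` and after `pₗ`, classes are born only at an index in
`P`, and they die only immediately after an index in `P`. For indices strictly between consecutive
`p, p' ∈ P` the space is therefore the image of `V p → V p'`. If `T` is a copy of `ℤ` and
`P = {0, …, l}`, these are the persistence modules `V₀ → V₁ → ⋯ → Vₗ`, extended by zero. -/
def FinitelyIndexed (V : PersMod F T) : Prop :=
  (∀ t : T, Module.Finite F (V.obj t)) ∧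
  ∃ P : Finset T,
    (∀ t : T, (∀ p ∈ P, t < p) → Subsingleton (V.obj t)) ∧
    (∀ t : T, (∀ p ∈ P, p < t) → Subsingleton (V.obj t)) ∧
    (∀ (s t : T) (h : s ≤ t), (∀ p ∈ P, ¬ (s < p ∧ p ≤ t)) →
      Function.Surjective (V.map (homOfLE h))) ∧
    (∀ (s t : T) (h : s ≤ t), (∀ p ∈ P, ¬ (s ≤ p ∧ p < t)) →
      Function.Injective (V.map (homOfLE h)))

variable (F) in
open Classical in
/-- The interval module `k_J`. Its value at `t` is `F` if `t ∈ J` (functions on a one-point type)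
and `0` otherwise (functions on an empty type); its inner maps are identities where possible. -/
noncomputable def intervalModule (J : Bar T) :
    PersMod F T where
  obj t := ModuleCat.of F (PLift (J.Mem t) → F)
  map {s _} _ := ModuleCat.ofHom
    { toFun := fun f _ => if hs : J.Mem s then f ⟨hs⟩ else 0
      map_add' := by
        intro f g; ext x; by_cases hs : J.Mem s <;> simp [hs]
      map_smul' := by
        intro c f; ext x; by_cases hs : J.Mem s <;> simp [hs] }
  map_id t := by
    refine ModuleCat.hom_ext (LinearMap.ext fun f => funext fun x => ?_)
    exact dif_pos x.down
  map_comp {r s t} hrs hst := by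
    refine ModuleCat.hom_ext (LinearMap.ext fun f => funext fun x => ?_)
    by_cases hr : J.Mem r
    · have hs : J.Mem s := ⟨hr.1.trans (leOfHom hrs), (leOfHom hst).trans x.down.2⟩
      simp [hr, hs]
    · simp [hr]

variable (F) in
open Classical in
/-- For `J ≼ I`, the morphism `k_I ⟶ k_J` that is the identity of `F` on `I ∩ J`, that is, the
morphism sending the generator of `I` to the generator of `J`. -/
noncomputable def intervalHom (I J : Bar T)
    (h : J.Overlaps I) : intervalModule F I ⟶ intervalModule F J where
  app t := ModuleCat.ofHom
    { toFun := fun f _ => if ht : I.Mem t then f ⟨ht⟩ else 0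
      map_add' := by
        intro f g; ext x; by_cases ht : I.Mem t <;> simp [ht]
      map_smul' := by
        intro c f; ext x; by_cases ht : I.Mem t <;> simp [ht] }
  naturality s t hst := by
    refine ModuleCat.hom_ext (LinearMap.ext fun f => funext fun (x : PLift (J.Mem t)) => ?_)
    obtain ⟨h1, h2, h3⟩ := h
    have hst' := leOfHom hst
    change (if _ : I.Mem t then (if hs : I.Mem s then f ⟨hs⟩ else 0) else 0) =
      (if _ : J.Mem s then (if hs : I.Mem s then f ⟨hs⟩ else 0) else 0)
    by_cases hs : I.Mem s
    · have ht : I.Mem t := ⟨hs.1.trans hst', x.down.2.trans h3⟩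
      have hs' : J.Mem s := ⟨h1.trans hs.1, hst'.trans x.down.2⟩
      simp [hs, ht, hs']
    · simp [hs]

/-- `S` is the multiset of intervals of some interval decomposition of `V`. -/
def IsBarcode (V : PersMod F T) (S : Multiset (Bar T)) : Prop :=
  ∃ (n : ℕ) (J : Fin n → Bar T), Finset.univ.val.map J = S ∧
    Nonempty (V ≅ ⨁ fun i => intervalModule F (J i))

open Classical in
/-- The barcode of `V`: the multiset of intervals in its interval decomposition. -/
noncomputable def barcode (V : PersMod F T) : Multiset (Bar T) :=
  if h : ∃ S, IsBarcode V S then h.choose else 0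

/-- The nestedness `Ξ(V)`: the minimal distance between corresponding endpoints of strictly nested
bars of `V`, and `∞` if no bars are strictly nested. -/
noncomputable def nestedness (V : PersMod F T) : EReal :=
  ⨅ I ∈ barcode V, ⨅ J ∈ barcode V, ⨅ _ : I.StrictlyNested J,
    ((min |(I.birth : ℝ) - J.birth| |(I.death : ℝ) - J.death| : ℝ) : EReal)

/-! ### Shifts and interleavings -/

/-- The shift `V ↦ V(a)`, where `V(a)_t = V_{t + a}`, as a functor. -/
def shift (a : T) : PersMod F T ⥤ PersMod F T :=
  (Functor.whiskeringLeft T T (ModuleCat.{u} F)).obj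
    (Monotone.functor (f := fun t : T => t + a) fun _ _ h => add_le_add_left h a)

/-- The inner morphisms `[a] : V ⟶ V(a)`. -/
def innerMap (V : PersMod F T) (a : T) (ha : 0 ≤ a) : V ⟶ (shift a).obj V where
  app t := V.map (homOfLE (le_add_of_nonneg_right ha))
  naturality s t hst := by
    change V.map _ ≫ V.map _ = V.map _ ≫ V.map _
    rw [← V.map_comp, ← V.map_comp]
    congr 1

/-- The identification `V(b)(a) = V(a + b)`. -/
def regroup (V : PersMod F T) (a b c : T) (h : a + b = c) :
    (shift a).obj ((shift b).obj V) ⟶ (shift c).obj V where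
  app t := V.map (homOfLE (show t + a + b ≤ t + c by rw [add_assoc, h]))
  naturality s t hst := by
    change V.map _ ≫ V.map _ = V.map _ ≫ V.map _
    rw [← V.map_comp, ← V.map_comp]
    congr 1

/-- `(Φ, Ψ)` is a `δ`-interleaving: `Ψ_{t+δ} ∘ Φ_t` and `Φ_{t+δ} ∘ Ψ_t` are the inner maps from
`t` to `t + 2δ`. -/
def IsInterleaving {V W : PersMod F T} (δ : T) (hδ : 0 ≤ δ)
    (Φ : V ⟶ (shift δ).obj W) (Ψ : W ⟶ (shift δ).obj V) : Prop :=
  Φ ≫ (shift δ).map Ψ ≫ regroup V δ δ (δ + δ) rfl = innerMap V (δ + δ) (add_nonneg hδ hδ) ∧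
  Ψ ≫ (shift δ).map Φ ≫ regroup W δ δ (δ + δ) rfl = innerMap W (δ + δ) (add_nonneg hδ hδ)

/-! ### Splittings -/

/-- A `q`-splitting `V ≅ V_{≥q} ⊕ V_{<q}`. -/
structure QSplitting (q : ℝ) (V : PersMod F T) where
  coarse : PersMod F T
  fine : PersMod F T
  iso : V ≅ coarse ⊞ fine
  le_length : ∀ J ∈ barcode coarse, q ≤ J.length
  length_lt : ∀ J ∈ barcode fine, J.length < q

namespace QSplitting

variable {q : ℝ} {V : PersMod F T} (S : QSplitting q V)

/-- The projection `V ⟶ V_{≥q}`. -/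
noncomputable def pr : V ⟶ S.coarse := S.iso.hom ≫ biprod.fst

/-- The inclusion `V_{≥q} ⟶ V`. -/
noncomputable def incl : S.coarse ⟶ V := biprod.inl ≫ S.iso.inv

/-- `φ_{≥q} = [h] ∘ pr : V ⟶ V_{≥q}(h)`, to be used for `h = q / 2`. -/
noncomputable def phi (h : T) (hh : 0 ≤ h) : V ⟶ (shift h).obj S.coarse :=
  S.pr ≫ innerMap S.coarse h hh

/-- `φ̃_{≥q} = incl(h) ∘ [h] : V_{≥q} ⟶ V(h)`, to be used for `h = q / 2`. -/
noncomputable def phiTilde (h : T) (hh : 0 ≤ h) : S.coarse ⟶ (shift h).obj V :=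
  innerMap S.coarse h hh ≫ (shift h).map S.incl

end QSplitting

/-! ### Ladder decompositions -/

/-- Labels of the elementary ladder persistence modules. -/
inductive ElemLadder (T : AddSubgroup ℝ) where
  /-- The bar `I` in the source, sent to the bar `J` in the target (where `J ≼ I`). -/
  | R (I J : Bar T) (h : J.Overlaps I)
  /-- The bar `I` in the source, and zero in the target. -/
  | plus (I : Bar T)
  /-- Zero in the source, and the bar `K` in the target. -/
  | minus (K : Bar T)

variable (F) in
open ZeroObject in
/-- The elementary ladder persistence module with a given label, as a morphism of persistence
modules. -/
noncomputable def ElemLadder.toArrow :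
    ElemLadder T → Arrow (PersMod F T)
  | .R I J h => Arrow.mk (intervalHom F I J h)
  | .plus I => Arrow.mk (0 : intervalModule F I ⟶ 0)
  | .minus K => Arrow.mk (0 : 0 ⟶ intervalModule F K)

/-- The ladder persistence module `Φ` is isomorphic to the direct sum of the elementary ladder
persistence modules listed in the multiset `D`. -/
def IsLadderDecomposition {X Y : PersMod F T} (Φ : X ⟶ Y) (D : Multiset (ElemLadder T)) : Prop :=
  ∃ (n : ℕ) (E : Fin n → ElemLadder T), Finset.univ.val.map E = D ∧
    Nonempty (Arrow.mk Φ ≅ Arrow.mk (biproduct.map fun i => ((E i).toArrow F).hom))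

/-! ### Matchings -/

/-- The pairs (bar of `X`, bar of `Y`) read off from a ladder decomposition `D` of a morphism
`X ⟶ Y(d)`: each summand `R` with source bar `I` and target bar `J` (a bar of `Y(d)`) contributes
the pair of `I` and the bar of `Y` that corresponds to `J`. -/
def matchingOf (d : T) (D : Multiset (ElemLadder T)) : Multiset (Bar T × Bar T) :=
  D.filterMap fun
    | .R I J _ => some (I, J.translate d)
    | .plus _ => none
    | .minus _ => none

/-- `Φ : X ⟶ Y(d)` has a ladder decomposition, and `χ` is the multiset of pairs of bars induced by
it (by whichever decomposition is used). -/
def InducesMatching {X Y : PersMod F T} (d : T) (Φ : X ⟶ (shift d).obj Y)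
    (χ : Multiset (Bar T × Bar T)) : Prop :=
  (∃ D, IsLadderDecomposition Φ D) ∧ ∀ D, IsLadderDecomposition Φ D → matchingOf d D = χ

/-- `χ` is a partial matching between the multisets `S₁` and `S₂`: no bar is used more often than
its multiplicity allows. -/
def IsPartialMatching (S₁ S₂ : Multiset (Bar T)) (χ : Multiset (Bar T × Bar T)) : Prop :=
  χ.map Prod.fst ≤ S₁ ∧ χ.map Prod.snd ≤ S₂

/-- The cost of a partial matching: the maximum of the distances between corresponding endpoints of
matched bars and of the half-lengths of unmatched bars (`0` if there are no bars). -/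
noncomputable def matchingCost (S₁ S₂ : Multiset (Bar T)) (χ : Multiset (Bar T × Bar T)) : ℝ :=
  (χ.map (fun p : Bar T × Bar T =>
      max |(p.1.birth : ℝ) - p.2.birth| |(p.1.death : ℝ) - p.2.death|) +
    ((S₁ - χ.map Prod.fst) + (S₂ - χ.map Prod.snd)).map
      (fun J : Bar T => J.length / 2)).fold max 0

/-- `χ` and `χ'` are partial matchings between `S₁` and `S₂`, in opposite directions, both of cost
at most `c`, and inverse to each other, with multiplicities, on bars of length at least `ℓ`. -/
structure IsInversePairOfMatchings (S₁ S₂ : Multiset (Bar T)) (c ℓ : ℝ)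
    (χ χ' : Multiset (Bar T × Bar T)) : Prop where
  matching : IsPartialMatching S₁ S₂ χ
  matching' : IsPartialMatching S₂ S₁ χ'
  cost_le : matchingCost S₁ S₂ χ ≤ c
  cost_le' : matchingCost S₂ S₁ χ' ≤ c
  count_eq : ∀ J ∈ S₁, ∀ K ∈ S₂, ℓ ≤ J.length → ℓ ≤ K.length →
    χ.count (J, K) = χ'.count (K, J)

end Modules

end PersLadder

open PersLadder

/-! The proof combines a compression argument with a restricted Gaussian elimination.

Compression. Every bar of `V_{<q}` is shorter than `q`, so inner maps over a distance at least `q`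
cannot distinguish `V` from its image under the idempotent `V → V_{≥q} → V`
(`QSplitting.tr_incl_pr`). Enlarging both shifts by `h = q/2` leaves a spare inner map of length `2h
= q` in each composite; by naturality it can be moved to the place where the idempotent sits and
absorbs it. All three pairs are instances of one statement about retracts, `interleaved_compress`,
with the identity as retract where a module is not split.

Elimination. Put `d = δ + q/2`. The nestedness hypothesis says that strictly nested bars differ by
more than `2d` at both endpoints. In chosen interval decompositions the morphism is a matrix, but a
base change may add one summand to another only along a morphism of interval modules. A nonzero
entry can serve as pivot if the bars of its row and of its column compare with it endpointwise in
the right direction. Bars that do not compare are strictly nested, and `exists_pivot` excludes this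
by means of the interleaving. The pivot splits off an elementary ladder (`exists_ladderSummand`),
the complements are again interleaved (`LadderSummand.interleaved`), and their bars are bars of the
original modules, so induction applies (`exists_ladderBasis`).

Counting. Multiplicities are compared through `card_le_of_pairing`: two bases of the same space give
matrices with product the identity, nonzero links squeeze a bar from both sides, and so an identity
matrix factors through the summands of the required type. This gives uniqueness of barcodes,
independence of the induced matching from the decomposition (`LadderBasis.card_le`) and, with the
interleaving relations, the symmetry on long bars (`LadderBasis.card_le_symm`).

Cost. On a bar of length at least `2d` the inner map over `2d` is nonzero, so the opposite morphism
leads back from the target to the source of the same ladder summand. Hence unmatched bars are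
shorter than `2d`, and matched endpoints differ by at most `d`. The bars of the fine parts are
shorter than `q ≤ 2d` and can be adjoined as unmatched bars. -/

namespace PersLadder

universe v

section Proofs

variable {F : Type v} [Field F] {T : AddSubgroup ℝ}

/-! ### Pointwise description of morphisms from and to interval modules -/

/-- The inner map `V_s → V_t` as a linear map. -/
noncomputable def tr (V : PersMod F T) {s t : T} (h : s ≤ t) : V.obj s →ₗ[F] V.obj t :=
  (V.map (homOfLE h)).hom

@[simp] lemma tr_self (V : PersMod F T) {t : T} (h : t ≤ t) (v : V.obj t) : tr V h v = v := by
  change (V.map (𝟙 t)).hom v = v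
  simp

lemma tr_tr (V : PersMod F T) {r s t : T} (h : r ≤ s) (h' : s ≤ t) (v : V.obj r) :
    tr V h' (tr V h v) = tr V (h.trans h') v := by
  change _ = (V.map (homOfLE h ≫ homOfLE h')).hom v
  rw [V.map_comp]
  rfl

lemma hom_apply {V W : PersMod F T} {Φ Ψ : V ⟶ W} (h : Φ = Ψ) {t : T} (v : V.obj t) :
    (Φ.app t).hom v = (Ψ.app t).hom v := by
  rw [h]

lemma app_tr {V W : PersMod F T} (Φ : V ⟶ W) {s t : T} (h : s ≤ t) (v : V.obj s) :
    (Φ.app t).hom (tr V h v) = tr W h ((Φ.app s).hom v) := by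
  have := Φ.naturality (homOfLE h)
  exact congrArg (fun g => g.hom v) this

/-- The set of indices in a bar. -/
def Bar.toSet (J : Bar T) : Set T := {t | J.Mem t}

lemma Bar.birth_mem (J : Bar T) : J.birth ∈ J.toSet := ⟨le_rfl, J.le⟩

lemma Bar.death_mem (J : Bar T) : J.death ∈ J.toSet := ⟨J.le, le_rfl⟩

lemma Bar.preimage_add (J : Bar T) (d : T) :
    (fun t => t + d) ⁻¹' J.toSet = (J.translate (-d)).toSet := by
  ext t
  simp [Bar.toSet, Bar.Mem, Bar.translate, ← sub_eq_add_neg, le_sub_iff_add_le]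

lemma Bar.translate_translate (J : Bar T) {c d : T} (h : c + d = 0) :
    (J.translate c).translate d = J := by
  ext <;> simp [Bar.translate, add_assoc, h]

/-- A family of vectors that describes a morphism from the interval module on `S` to `V`. -/
structure IsSection (V : PersMod F T) (S : Set T) (e : ∀ t, V.obj t) : Prop where
  zero : ∀ t, t ∉ S → e t = 0
  map : ∀ {s t : T} (h : s ≤ t), s ∈ S → tr V h (e s) = e t

/-- A family of functionals that describes a morphism from `V` to the interval module on `S`. -/
structure IsCosection (V : PersMod F T) (S : Set T) (f : ∀ t, V.obj t →ₗ[F] F) : Prop where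
  zero : ∀ t, t ∉ S → f t = 0
  map : ∀ {s t : T} (h : s ≤ t), t ∈ S → ∀ v, f t (tr V h v) = f s v

lemma IsSection.comp {V W : PersMod F T} {S : Set T} {e : ∀ t, V.obj t} (he : IsSection V S e)
    (Φ : V ⟶ W) : IsSection W S (fun t => (Φ.app t).hom (e t)) where
  zero t ht := by simp [he.zero t ht]
  map h hs := by rw [← app_tr, he.map h hs]

lemma IsCosection.comp {V W : PersMod F T} {S : Set T} {f : ∀ t, W.obj t →ₗ[F] F}
    (hf : IsCosection W S f) (Φ : V ⟶ W) :
    IsCosection V S (fun t => (f t).comp (Φ.app t).hom) where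
  zero t ht := by simp [hf.zero t ht]
  map h hs v := by
    simp only [LinearMap.comp_apply]
    rw [app_tr, hf.map h hs]

lemma IsSection.shift {V : PersMod F T} {S : Set T} {e : ∀ t, V.obj t} (he : IsSection V S e)
    (d : T) : IsSection ((shift d).obj V) ((fun t => t + d) ⁻¹' S) (fun t => e (t + d)) where
  zero _ ht := he.zero _ ht
  map h hs := he.map (add_le_add_left h d) hs

lemma IsCosection.shift {V : PersMod F T} {S : Set T} {f : ∀ t, V.obj t →ₗ[F] F}
    (hf : IsCosection V S f) (d : T) :
    IsCosection ((shift d).obj V) ((fun t => t + d) ⁻¹' S) (fun t => f (t + d)) where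
  zero _ ht := hf.zero _ ht
  map h hs v := hf.map (add_le_add_left h d) hs v

section Pairing

variable {V : PersMod F T} {S S' : Set T} {e : ∀ t, V.obj t} {f : ∀ t, V.obj t →ₗ[F] F}

/-- A section followed by a cosection is a morphism between interval modules, which is a single
scalar wherever both are supported. Matrix entries may therefore be evaluated at any convenient
index. -/
lemma pairing_eq (he : IsSection V S e) (hf : IsCosection V S' f) {s t : T} (h : s ≤ t)
    (hs : s ∈ S) (ht : t ∈ S') : f t (e t) = f s (e s) := by
  rw [← he.map h hs, hf.map h ht]

lemma mem_of_pairing_ne_zero (he : IsSection V S e) (hf : IsCosection V S' f) {t : T}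
    (h : f t (e t) ≠ 0) : t ∈ S ∧ t ∈ S' := by
  constructor <;> by_contra ht
  · simp [he.zero t ht] at h
  · simp [hf.zero t ht] at h

/-- A nonzero morphism from the interval module of `I` to that of `J` forces `J ≼ I`. -/
lemma le_of_pairing_ne_zero {I J : Bar T} (he : IsSection V I.toSet e)
    (hf : IsCosection V J.toSet f) {t : T} (h : f t (e t) ≠ 0) :
    J.birth ≤ I.birth ∧ J.death ≤ I.death := by
  obtain ⟨hI, hJ⟩ := mem_of_pairing_ne_zero he hf h
  constructor
  -- Moved back to the birth of `I`, the pairing is still nonzero, so that index lies in `J`. Moving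
  -- it forward to the death of `J` works dually.
  · have := pairing_eq he hf hI.1 I.birth_mem hJ
    exact (mem_of_pairing_ne_zero he hf (this ▸ h)).2.1
  · have := pairing_eq he hf hJ.2 hI J.death_mem
    exact (mem_of_pairing_ne_zero he hf (this.symm ▸ h)).1.2

end Pairing

/-! ### Splitting off an interval module -/

section Complement

variable {V : PersMod F T} {S : Set T} {e : ∀ t, V.obj t} {f : ∀ t, V.obj t →ₗ[F] F}

lemma IsCosection.tr_mem_ker (hf : IsCosection V S f) {s t : T} (h : s ≤ t)
    {v : V.obj s} (hv : f s v = 0) : f t (tr V h v) = 0 := by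
  by_cases ht : t ∈ S
  · rw [hf.map h ht, hv]
  · simp [hf.zero t ht]

variable (V) in
/-- The kernel of a morphism to an interval module. -/
noncomputable def kerMod (hf : IsCosection V S f) : PersMod F T where
  obj t := ModuleCat.of F (LinearMap.ker (f t))
  map {s t} h := ModuleCat.ofHom ((tr V (leOfHom h)).restrict
    (p := LinearMap.ker (f s)) (q := LinearMap.ker (f t))
    (fun v hv => hf.tr_mem_ker (leOfHom h) hv))
  map_id t := by
    refine ModuleCat.hom_ext (LinearMap.ext fun v => ?_)
    exact Subtype.ext (tr_self V _ v.1)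
  map_comp h h' := by
    refine ModuleCat.hom_ext (LinearMap.ext fun v => ?_)
    exact Subtype.ext (tr_tr V (leOfHom h) (leOfHom h') v.1).symm

variable (V) in
/-- The inclusion of the kernel. -/
noncomputable def kerIncl (hf : IsCosection V S f) : kerMod V hf ⟶ V where
  app t := ModuleCat.ofHom (X := LinearMap.ker (f t)) (Y := V.obj t) (LinearMap.ker (f t)).subtype
  naturality _ _ _ := rfl

variable (V) in
-- Naturality of the idempotent that projects to the span of `e`. It holds across the boundary of
-- `S` too: there either the functional or the vector vanishes on each side.
lemma proj_tr (he : IsSection V S e) (hf : IsCosection V S f) {s t : T} (h : s ≤ t)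
    (v : V.obj s) : f t (tr V h v) • e t = tr V h (f s v • e s) := by
  rw [map_smul]
  by_cases hs : s ∈ S
  · rw [he.map h hs]
    by_cases ht : t ∈ S
    · rw [hf.map h ht]
    · simp [he.zero t ht]
  · rw [hf.zero s hs]
    by_cases ht : t ∈ S
    · rw [hf.map h ht, hf.zero s hs]
      simp
    · simp [he.zero t ht]

lemma sub_mem_ker (hf : IsCosection V S f) (h1 : ∀ t ∈ S, f t (e t) = 1)
    {t : T} (v : V.obj t) : v - f t v • e t ∈ LinearMap.ker (f t) := by
  by_cases ht : t ∈ S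
  · simp [h1 t ht]
  · simp [hf.zero t ht]

variable (V) in
/-- The retraction onto the kernel. -/
noncomputable def kerRetr (he : IsSection V S e) (hf : IsCosection V S f)
    (h1 : ∀ t ∈ S, f t (e t) = 1) : V ⟶ kerMod V hf where
  app t := ModuleCat.ofHom (X := V.obj t) (Y := LinearMap.ker (f t)) (LinearMap.codRestrict (LinearMap.ker (f t))
    (LinearMap.id - (f t).smulRight (e t)) (fun v => sub_mem_ker hf h1 v))
  naturality s t h := by
    refine ModuleCat.hom_ext (LinearMap.ext fun v => ?_)
    refine Subtype.ext ?_
    change tr V (leOfHom h) v - f t (tr V (leOfHom h) v) • e t = tr V (leOfHom h) (v - f s v • e s)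
    rw [proj_tr V he hf, map_sub]

lemma kerIncl_retr (he : IsSection V S e) (hf : IsCosection V S f)
    (h1 : ∀ t ∈ S, f t (e t) = 1) : kerIncl V hf ≫ kerRetr V he hf h1 = 𝟙 _ := by
  refine NatTrans.ext (funext fun t => ModuleCat.hom_ext (LinearMap.ext fun v => ?_))
  refine Subtype.ext ?_
  change v.1 - f t v.1 • e t = v.1
  rw [show f t v.1 = 0 from v.2]
  simp

end Complement

/-! ### Interval decompositions -/

/-- A decomposition of `V` into the interval modules on the sets `S i`: compatible bases of the
spaces `V_t` and their dual bases. -/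
structure BarBasis (V : PersMod F T) {ι : Type} [Fintype ι] (S : ι → Set T) where
  e : ∀ _ : ι, ∀ t, V.obj t
  f : ∀ _ : ι, ∀ t, V.obj t →ₗ[F] F
  isSection : ∀ i, IsSection V (S i) (e i)
  isCosection : ∀ i, IsCosection V (S i) (f i)
  self : ∀ i, ∀ t ∈ S i, f i t (e i t) = 1
  ne : ∀ i j, i ≠ j → ∀ t, f i t (e j t) = 0
  total : ∀ t v, ∑ i, f i t v • e i t = v

namespace BarBasis

variable {V : PersMod F T} {ι : Type} [Fintype ι]

/-- Adjoins an interval summand to an interval decomposition of its complement. -/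
noncomputable def cons {S : Option ι → Set T} {e : ∀ t, V.obj t} {f : ∀ t, V.obj t →ₗ[F] F}
    (he : IsSection V (S none) e) (hf : IsCosection V (S none) f)
    (h1 : ∀ t ∈ S none, f t (e t) = 1)
    (B : BarBasis (kerMod V hf) (fun i => S (some i))) : BarBasis V S where
  e o := match o with
    | none => e
    | some i => fun t => ((kerIncl V hf).app t).hom (B.e i t)
  f o := match o with
    | none => f
    | some i => fun t => (B.f i t).comp ((kerRetr V he hf h1).app t).hom
  isSection o := match o with
    | none => he
    | some i => (B.isSection i).comp _
  isCosection o := match o with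
    | none => hf
    | some i => (B.isCosection i).comp _
  self o := match o with
    | none => h1
    | some i => fun t ht => by
      have := hom_apply (kerIncl_retr he hf h1) (B.e i t)
      exact (congrArg (B.f i t) this).trans (B.self i t ht)
  ne o o' h t := match o, o', h with
    | none, none, h => absurd rfl h
    | none, some j, _ => (show LinearMap.ker (f t) from B.e j t).2
    | some i, none, _ => by
      change B.f i t (((kerRetr V he hf h1).app t).hom (e t)) = 0
      have : ((kerRetr V he hf h1).app t).hom (e t) = 0 := by
        refine Subtype.ext (p := (· ∈ LinearMap.ker (f t))) ?_
        change e t - f t (e t) • e t = 0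
        by_cases ht : t ∈ S none
        · simp [h1 t ht]
        · simp [he.zero t ht]
      rw [this, map_zero]
    | some i, some j, h => by
      have := hom_apply (kerIncl_retr he hf h1) (B.e j t)
      exact (congrArg (B.f i t) this).trans (B.ne i j (fun h' => h (congrArg some h')) t)
  total t v := by
    rw [Fintype.sum_option]
    have h2 := congrArg ((kerIncl V hf).app t).hom
      (B.total t (((kerRetr V he hf h1).app t).hom v))
    rw [map_sum] at h2
    simp only [map_smul] at h2
    refine (congrArg (f t v • e t + ·) h2).trans ?_
    change f t v • e t + (v - f t v • e t) = v
    abel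

/-- Shifts an interval decomposition. -/
noncomputable def shift {S : ι → Set T} (B : BarBasis V S) (d : T) :
    BarBasis ((shift d).obj V) (fun i => (fun t => t + d) ⁻¹' S i) where
  e i t := B.e i (t + d)
  f i t := B.f i (t + d)
  isSection i := (B.isSection i).shift d
  isCosection i := (B.isCosection i).shift d
  self i _ ht := B.self i _ ht
  ne i j h _ := B.ne i j h _
  total _ v := B.total _ v

/-- Reindexes an interval decomposition. -/
noncomputable def reindex {S : ι → Set T} (B : BarBasis V S) {κ : Type} [Fintype κ]
    (σ : κ ≃ ι) : BarBasis V (fun k => S (σ k)) where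
  e k := B.e (σ k)
  f k := B.f (σ k)
  isSection _ := B.isSection _
  isCosection _ := B.isCosection _
  self _ := B.self _
  ne _ _ h := B.ne _ _ (fun h' => h (σ.injective h'))
  total t v := (σ.sum_comp (fun i => B.f i t v • B.e i t)).trans (B.total t v)

/-- The interval decomposition of a zero module. -/
noncomputable def ofSubsingleton (hV : ∀ t, Subsingleton (V.obj t)) (S : Empty → Set T) :
    BarBasis V S where
  e := nofun
  f := nofun
  isSection := nofun
  isCosection := nofun
  self := nofun
  ne := nofun
  total t _ := (hV t).elim _ _

end BarBasis

/-! ### Existence of interval decompositions -/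

/-- `V` is determined by its spaces at the finitely many indices in `P`. -/
structure IsIndexedBy (V : PersMod F T) (P : Finset T) : Prop where
  before : ∀ t : T, (∀ p ∈ P, t < p) → Subsingleton (V.obj t)
  after : ∀ t : T, (∀ p ∈ P, p < t) → Subsingleton (V.obj t)
  surj : ∀ (s t : T) (h : s ≤ t), (∀ p ∈ P, ¬ (s < p ∧ p ≤ t)) → Function.Surjective (tr V h)
  inj : ∀ (s t : T) (h : s ≤ t), (∀ p ∈ P, ¬ (s ≤ p ∧ p < t)) → Function.Injective (tr V h)

lemma finitelyIndexed_iff {V : PersMod F T} :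
    FinitelyIndexed V ↔ (∀ t, Module.Finite F (V.obj t)) ∧ ∃ P, IsIndexedBy V P :=
  ⟨fun ⟨h, P, h1, h2, h3, h4⟩ => ⟨h, P, h1, h2, h3, h4⟩,
    fun ⟨h, P, h1, h2, h3, h4⟩ => ⟨h, P, h1, h2, h3, h4⟩⟩

section Retract

variable {V W : PersMod F T} {i : V ⟶ W} {r : W ⟶ V}

lemma retract_apply (h : i ≫ r = 𝟙 V) {t : T} (v : V.obj t) :
    (r.app t).hom ((i.app t).hom v) = v :=
  hom_apply h v

/-- The inner maps of `V` are retracts of those of `W`, and injectivity, surjectivity and vanishing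
pass to retracts. Complements thus keep the same index set `P`. -/
lemma IsIndexedBy.retract (h : i ≫ r = 𝟙 V) {P : Finset T} (hP : IsIndexedBy W P) :
    IsIndexedBy V P := by
  have hinj (t : T) : Function.Injective ((i.app t).hom) :=
    Function.LeftInverse.injective (fun v => retract_apply h v)
  refine ⟨fun t ht => ?_, fun t ht => ?_, fun s t hst hp v => ?_, fun s t hst hp v w hvw => ?_⟩
  · have := hP.before t ht
    exact (hinj t).subsingleton
  · have := hP.after t ht
    exact (hinj t).subsingleton
  · obtain ⟨w, hw⟩ := hP.surj s t hst hp ((i.app t).hom v)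
    refine ⟨(r.app s).hom w, ?_⟩
    rw [← app_tr, hw, retract_apply h]
  · refine hinj s (hP.inj s t hst hp ?_)
    rw [← app_tr, ← app_tr, hvw]

lemma finite_of_retract (h : i ≫ r = 𝟙 V) {t : T} [Module.Finite F (W.obj t)] :
    Module.Finite F (V.obj t) :=
  Module.Finite.of_injective (i.app t).hom
    (Function.LeftInverse.injective (fun v => retract_apply h v))

lemma FinitelyIndexed.retract (h : i ≫ r = 𝟙 V) (hW : FinitelyIndexed W) :
    FinitelyIndexed V := by
  rw [finitelyIndexed_iff] at hW ⊢
  obtain ⟨hf, P, hP⟩ := hW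
  exact ⟨fun t => have := hf t; finite_of_retract h, P, hP.retract h⟩

end Retract

/-- A nonzero finitely indexed module has an interval summand that is born first. -/
lemma IsIndexedBy.exists_summand {V : PersMod F T} {P : Finset T} (hP : IsIndexedBy V P)
    {t₀ : T} (ht₀ : Nontrivial (V.obj t₀)) :
    ∃ (I : Bar T) (e : ∀ t, V.obj t) (f : ∀ t, V.obj t →ₗ[F] F), I.birth ∈ P ∧
      IsSection V I.toSet e ∧ IsCosection V I.toSet f ∧ ∀ t ∈ I.toSet, f t (e t) = 1 := by
  classical
  -- Everything alive at `t` comes from the last index of `P` before or at `t`.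
  have key (t : T) (ht : Nontrivial (V.obj t)) : ∃ p ∈ P, p ≤ t ∧ Nontrivial (V.obj p) := by
    have hne : (P.filter (· ≤ t)).Nonempty := by
      by_contra hne
      rw [Finset.not_nonempty_iff_eq_empty, Finset.filter_eq_empty_iff] at hne
      exact not_subsingleton _ (hP.before t fun p hp => not_le.mp (hne hp))
    have hmem := Finset.max'_mem _ hne
    set p := (P.filter (· ≤ t)).max' hne
    rw [Finset.mem_filter] at hmem
    refine ⟨p, hmem.1, hmem.2, ?_⟩
    refine (hP.surj p t hmem.2 fun p' hp' h => ?_).nontrivial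
    exact absurd (Finset.le_max' _ p' (Finset.mem_filter.mpr ⟨hp', h.2⟩)) (not_le.mpr h.1)
  obtain ⟨p₀, hp₀, -, hn₀⟩ := key t₀ ht₀
  have hne : (P.filter fun p => Nontrivial (V.obj p)).Nonempty :=
    ⟨p₀, Finset.mem_filter.mpr ⟨hp₀, hn₀⟩⟩
  obtain ⟨a, haP, ha, hmin⟩ : ∃ a ∈ P, Nontrivial (V.obj a) ∧ ∀ s < a, Subsingleton (V.obj s) := by
    have hmem := Finset.min'_mem _ hne
    rw [Finset.mem_filter] at hmem
    refine ⟨_, hmem.1, hmem.2, fun s hs => ?_⟩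
    by_contra hsub
    rw [not_subsingleton_iff_nontrivial] at hsub
    obtain ⟨p, hp, hps, hpn⟩ := key s hsub
    exact absurd (Finset.min'_le _ p (Finset.mem_filter.mpr ⟨hp, hpn⟩))
      (not_le.mpr (hps.trans_lt hs))
  -- The death `b` will be the last index of `P` to which the first nonzero space `V a` still maps
  -- injectively.
  have hne' : (P.filter fun p => ∃ h : a ≤ p, Function.Injective (tr V h)).Nonempty :=
    ⟨a, Finset.mem_filter.mpr ⟨haP, le_rfl, fun v w h => by simpa using h⟩⟩
  have hmem := Finset.max'_mem _ hne'
  have hmax := fun p hp => Finset.le_max' (P.filter fun p => ∃ h : a ≤ p,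
    Function.Injective (tr V h)) p hp
  set b := (P.filter fun p => ∃ h : a ≤ p, Function.Injective (tr V h)).max' hne'
  rw [Finset.mem_filter] at hmem
  obtain ⟨-, hab, hinj⟩ := hmem
  -- Injectivity fails at the next index of `P`, and deaths occur only immediately after indices in
  -- `P`. So a vector in that kernel is already dead everywhere after `b`.
  obtain ⟨v, hv, hdies⟩ : ∃ v : V.obj a, v ≠ 0 ∧ ∀ t (h : a ≤ t), b < t → tr V h v = 0 := by
    by_cases hn : (P.filter (b < ·)).Nonempty
    · have hm := Finset.min'_mem _ hn
      have hm' := fun p hp => Finset.min'_le (P.filter (b < ·)) p hp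
      set p := (P.filter (b < ·)).min' hn
      rw [Finset.mem_filter] at hm
      have hap : a ≤ p := hab.trans hm.2.le
      have hni : ¬ Function.Injective (tr V hap) := fun hi =>
        absurd (hmax p (Finset.mem_filter.mpr ⟨hm.1, hap, hi⟩)) (not_le.mpr hm.2)
      rw [← LinearMap.ker_eq_bot, Submodule.eq_bot_iff] at hni
      push Not at hni
      obtain ⟨v, hv0, hv⟩ := hni
      refine ⟨v, hv, fun t hat hbt => ?_⟩
      rcases le_total t p with htp | hpt
      · refine hP.inj t p htp (fun p' hp' h => ?_) ?_
        · exact absurd (hm' p' (Finset.mem_filter.mpr ⟨hp', hbt.trans_le h.1⟩)) (not_le.mpr h.2)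
        · rw [tr_tr, map_zero]
          exact hv0
      · rw [← tr_tr V hap hpt, show tr V hap v = 0 from hv0, map_zero]
    · obtain ⟨v, hv⟩ := exists_ne (0 : V.obj a)
      refine ⟨v, hv, fun t h hbt => ?_⟩
      rw [Finset.not_nonempty_iff_eq_empty, Finset.filter_eq_empty_iff] at hn
      have := hP.after t fun p hp => (not_lt.mp (hn hp)).trans_lt hbt
      exact Subsingleton.elim _ _
  have hvb : tr V hab v ≠ 0 := fun h => hv (hinj (h.trans (map_zero _).symm))
  -- A functional dual to `v` at the end of its life, pulled back along the inner maps. Extension by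
  -- zero to the left is compatible because `V` vanishes before `a`.
  obtain ⟨g, hg⟩ := Module.Projective.exists_dual_eq_one F hvb
  refine ⟨⟨a, b, hab⟩, fun t => if h : a ≤ t then tr V h v else 0,
    fun t => if h : a ≤ t ∧ t ≤ b then g.comp (tr V h.2) else 0, haP, ⟨?_, ?_⟩, ⟨?_, ?_⟩, ?_⟩
  · intro t ht
    by_cases h : a ≤ t
    · simp only [h, dif_pos]
      exact hdies t h (not_le.mp fun h' => ht ⟨h, h'⟩)
    · simp [h]
  · intro s t hst hs
    have has : a ≤ s := hs.1
    simp [has, has.trans hst, tr_tr]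
  · intro t ht
    exact dif_neg ht
  · intro s t hst ht v
    have h : a ≤ t ∧ t ≤ b := ht
    by_cases has : a ≤ s
    · have h' : a ≤ s ∧ s ≤ b := ⟨has, hst.trans h.2⟩
      simp [h, h', tr_tr]
    · have := hmin s (not_le.mp has)
      rw [Subsingleton.elim v 0]
      simp
  · intro t ht
    have h : a ≤ t ∧ t ≤ b := ht
    simp [h, tr_tr, hg]

/-- Interval decompositions exist. -/
theorem FinitelyIndexed.exists_barBasis {V : PersMod F T} (hV : FinitelyIndexed V) :
    ∃ (ι : Type) (_ : Fintype ι) (J : ι → Bar T),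
      Nonempty (BarBasis V fun i => (J i).toSet) := by
  rw [finitelyIndexed_iff] at hV
  obtain ⟨hfin, P, hP⟩ := hV
  -- The total dimension over the fixed set `P` drops when a summand is removed, since its birth
  -- lies in `P`.
  induction hn : ∑ p ∈ P, Module.finrank F (V.obj p) using Nat.strong_induction_on generalizing V
    with | _ n ih
  by_cases h0 : ∀ t, Subsingleton (V.obj t)
  · exact ⟨Empty, inferInstance, nofun, ⟨.ofSubsingleton h0 _⟩⟩
  push Not at h0
  obtain ⟨t₀, ht₀⟩ := h0
  obtain ⟨I, e, f, hIP, he, hf, h1⟩ := hP.exists_summand ht₀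
  have hr := kerIncl_retr he hf h1
  have hlt : ∑ p ∈ P, Module.finrank F ((kerMod V hf).obj p) < n := by
    rw [← hn]
    refine Finset.sum_lt_sum (fun p _ => ?_) ⟨I.birth, hIP, ?_⟩
    · have := hfin p
      exact Submodule.finrank_le (LinearMap.ker (f p))
    · have := hfin I.birth
      refine Submodule.finrank_lt (s := LinearMap.ker (f I.birth)) fun htop => ?_
      have h2 : e I.birth ∈ LinearMap.ker (f I.birth) := htop ▸ Submodule.mem_top
      rw [LinearMap.mem_ker, h1 _ I.birth_mem] at h2
      exact one_ne_zero h2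
  obtain ⟨ι, _, J, ⟨B⟩⟩ := ih _ hlt
    (fun t => have := hfin t; finite_of_retract hr) (hP.retract hr) rfl
  exact ⟨Option ι, inferInstance, fun o => o.elim I J,
    ⟨BarBasis.cons (S := fun o => (o.elim I J).toSet) he hf h1 B⟩⟩

/-! ### Interval decompositions as isomorphisms with direct sums -/

open Classical in
/-- The coordinate of a vector in an interval module. -/
noncomputable def intervalCoord (J : Bar T) (t : T) : (intervalModule F J).obj t →ₗ[F] F where
  toFun v := if h : J.Mem t then (show PLift (J.Mem t) → F from v) ⟨h⟩ else 0
  map_add' v w := by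
    split_ifs
    · rfl
    · exact (add_zero _).symm
  map_smul' c v := by
    split_ifs
    · rfl
    · exact (smul_zero _).symm

lemma intervalCoord_of_mem {J : Bar T} {t : T} (h : J.Mem t) (v : (intervalModule F J).obj t) :
    intervalCoord J t v = (show PLift (J.Mem t) → F from v) ⟨h⟩ := dif_pos h

lemma intervalCoord_of_not_mem {J : Bar T} {t : T} (h : ¬ J.Mem t)
    (v : (intervalModule F J).obj t) : intervalCoord J t v = 0 := dif_neg h

/-- The tautological basis of an interval module. -/
noncomputable def intervalBasis (J : Bar T) :
    BarBasis (intervalModule F J) (fun _ : Unit => J.toSet) where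
  e _ t := fun _ : PLift (J.Mem t) => (1 : F)
  f _ t := intervalCoord J t
  isSection _ := by
    refine ⟨fun t ht => funext fun x => absurd x.down ht, fun {s t} h hs => ?_⟩
    funext x
    exact dif_pos hs
  isCosection _ := by
    refine ⟨fun t ht => LinearMap.ext fun v => intervalCoord_of_not_mem ht v,
      fun {s t} h ht v => ?_⟩
    refine (intervalCoord_of_mem ht _).trans ?_
    by_cases hs : J.Mem s
    · rw [intervalCoord_of_mem hs]
      exact dif_pos hs
    · rw [intervalCoord_of_not_mem hs]
      exact dif_neg hs
  self _ t ht := intervalCoord_of_mem ht _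
  ne i j h := absurd rfl h
  total t v := by
    rw [Fintype.sum_unique]
    funext x
    refine (congrArg (· * (1 : F)) (intervalCoord_of_mem x.down v)).trans (mul_one _)

open ZeroObject in
/-- The empty basis of the zero module. -/
noncomputable def zeroBasis : BarBasis (0 : PersMod F T) (fun _ : Unit => ∅) where
  e _ t := 0
  f _ t := 0
  isSection _ := ⟨fun _ _ => rfl, fun _ _ => map_zero _⟩
  isCosection _ := ⟨fun _ _ => rfl, fun _ _ _ => rfl⟩
  self _ t ht := absurd ht (Set.notMem_empty t)
  ne i j h := absurd rfl h
  total t v := by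
    have h : 𝟙 (0 : PersMod F T) = 0 := (isZero_zero _).eq_of_src _ _
    exact (Finset.sum_eq_zero fun _ _ => smul_zero _).trans (hom_apply h v).symm

lemma sum_hom_apply {V W : PersMod F T} {κ : Type} (s : Finset κ) (g : κ → (V ⟶ W)) {t : T}
    (v : V.obj t) : ((∑ i ∈ s, g i).app t).hom v = ∑ i ∈ s, ((g i).app t).hom v := by
  simp [NatTrans.app_sum, ModuleCat.hom_sum]

namespace BarBasis

variable {V W : PersMod F T} {ι : Type} [Fintype ι] {S : ι → Set T}

/-- The interval decomposition obtained from a direct sum decomposition into interval modules. -/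
noncomputable def glue {X : ι → PersMod F T} (B : ∀ i, BarBasis (X i) (fun _ : Unit => S i))
    (inc : ∀ i, X i ⟶ V) (proj : ∀ i, V ⟶ X i) (hself : ∀ i, inc i ≫ proj i = 𝟙 _)
    (hne : ∀ i j, i ≠ j → inc i ≫ proj j = 0) (htot : ∑ i, proj i ≫ inc i = 𝟙 V) :
    BarBasis V S where
  e i t := ((inc i).app t).hom ((B i).e () t)
  f i t := ((B i).f () t).comp ((proj i).app t).hom
  isSection i := ((B i).isSection ()).comp _
  isCosection i := ((B i).isCosection ()).comp _
  self i t ht := by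
    have := hom_apply (hself i) ((B i).e () t)
    exact (congrArg _ this).trans ((B i).self () t ht)
  ne i j h t := by
    have := hom_apply (hne j i h.symm) ((B j).e () t)
    exact (congrArg ((B i).f () t) this).trans (map_zero ((B i).f () t))
  total t v := by
    have h1 := hom_apply htot v
    rw [sum_hom_apply] at h1
    refine (Finset.sum_congr rfl fun i _ => ?_).trans h1
    have h2 := (B i).total t (((proj i).app t).hom v)
    rw [Fintype.sum_unique] at h2
    rw [← map_smul]
    exact congrArg ((inc i).app t).hom h2

lemma smul_tr (B : BarBasis V S) (i : ι) {M : PersMod F T} {g : ∀ t, M.obj t}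
    (hg : IsSection M (S i) g) {s t : T} (h : s ≤ t) (v : V.obj s) :
    B.f i t (tr V h v) • g t = tr M h (B.f i s v • g s) := by
  rw [map_smul]
  by_cases hs : s ∈ S i
  · rw [hg.map h hs]
    by_cases ht : t ∈ S i
    · rw [(B.isCosection i).map h ht]
    · simp [hg.zero t ht]
  · rw [hg.zero s hs, map_zero, smul_zero]
    by_cases ht : t ∈ S i
    · rw [(B.isCosection i).map h ht, (B.isCosection i).zero s hs]
      simp
    · simp [hg.zero t ht]

/-- The morphism between two modules that sends one basis family to another. -/
noncomputable def toHom (B : BarBasis V S) (i : ι) {M : PersMod F T} {g : ∀ t, M.obj t}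
    (hg : IsSection M (S i) g) : V ⟶ M where
  app t := ModuleCat.ofHom ((B.f i t).smulRight (g t))
  naturality s t h := by
    refine ModuleCat.hom_ext (LinearMap.ext fun v => ?_)
    exact B.smul_tr i hg (leOfHom h) v

end BarBasis

section Bicone

variable {V : PersMod F T} {n : ℕ} {S : Fin n → Set T} {X : Fin n → PersMod F T}

lemma hom_ext_apply {V W : PersMod F T} {Φ Ψ : V ⟶ W}
    (h : ∀ t v, (Φ.app t).hom v = (Ψ.app t).hom v) : Φ = Ψ :=
  NatTrans.ext (funext fun t => ModuleCat.hom_ext (LinearMap.ext fun v => h t v))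

open Classical in
/-- The bicone over interval modules that belongs to an interval decomposition. -/
noncomputable def BarBasis.bicone (B : BarBasis V S)
    (E : ∀ i, BarBasis (X i) (fun _ : Unit => S i)) : Bicone X where
  pt := V
  ι i := (E i).toHom () (B.isSection i)
  π i := B.toHom i ((E i).isSection ())
  ι_π i j := by
    split_ifs with h
    · subst h
      refine hom_ext_apply fun t v => ?_
      change B.f i t ((E i).f () t v • B.e i t) • (E i).e () t = v
      have h2 := (E i).total t v
      rw [Fintype.sum_unique] at h2
      rw [map_smul, smul_eq_mul]
      by_cases ht : t ∈ S i
      · rw [B.self i t ht, mul_one]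
        exact h2
      · rw [((E i).isSection ()).zero t ht, smul_zero]
        rw [← h2]
        exact ((congrArg _ (((E i).isSection ()).zero t ht)).trans (smul_zero _)).symm
    · refine hom_ext_apply fun t v => ?_
      change B.f j t ((E i).f () t v • B.e i t) • (E j).e () t = 0
      rw [map_smul, B.ne j i (Ne.symm h), smul_zero, zero_smul]

/-- This bicone is a direct sum. -/
noncomputable def BarBasis.isBilimit (B : BarBasis V S)
    (E : ∀ i, BarBasis (X i) (fun _ : Unit => S i)) : (B.bicone E).IsBilimit := by
  refine isBilimitOfTotal _ (hom_ext_apply fun t v => ?_)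
  rw [sum_hom_apply]
  refine Eq.trans (Finset.sum_congr rfl fun i _ => ?_) (B.total t v)
  change (E i).f () t (B.f i t v • (E i).e () t) • B.e i t = B.f i t v • B.e i t
  rw [map_smul, smul_eq_mul]
  by_cases ht : t ∈ S i
  · rw [(E i).self () t ht, mul_one]
  · rw [(B.isSection i).zero t ht, smul_zero, smul_zero]

/-- The isomorphism with a direct sum of interval modules that belongs to an interval
decomposition. -/
noncomputable def BarBasis.iso (B : BarBasis V S)
    (E : ∀ i, BarBasis (X i) (fun _ : Unit => S i)) : V ≅ ⨁ X :=
  biproduct.uniqueUpToIso X (B.isBilimit E)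

lemma BarBasis.iso_hom_π (B : BarBasis V S)
    (E : ∀ i, BarBasis (X i) (fun _ : Unit => S i)) (i : Fin n) :
    (B.iso E).hom ≫ biproduct.π X i = B.toHom i ((E i).isSection ()) := by
  rw [BarBasis.iso, biproduct.uniqueUpToIso_hom]
  exact biproduct.lift_π _ _

/-- The interval decomposition that belongs to an isomorphism with a direct sum. -/
noncomputable def BarBasis.ofIso (E : ∀ i, BarBasis (X i) (fun _ : Unit => S i))
    (φ : V ≅ ⨁ X) : BarBasis V S :=
  BarBasis.glue E (fun i => biproduct.ι X i ≫ φ.inv) (fun i => φ.hom ≫ biproduct.π X i)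
    (fun i => by simp) (fun i j h => by simp [biproduct.ι_π_ne X h])
    (by
      have h : ∑ i, (φ.hom ≫ biproduct.π X i) ≫ biproduct.ι X i ≫ φ.inv =
          φ.hom ≫ (∑ i, biproduct.π X i ≫ biproduct.ι X i) ≫ φ.inv := by
        simp only [Preadditive.sum_comp, Preadditive.comp_sum, Category.assoc]
      rw [h, biproduct.total, Category.id_comp, Iso.hom_inv_id])

end Bicone

/-! ### Uniqueness of barcodes -/

/-- The hypotheses say that the identity matrix on `α` factors through `β`; its rank is at most the
size of `β`. -/
lemma card_le_of_matrix {α β : Type} [Fintype α] [Fintype β] (A : β → α → F) (B : α → β → F)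
    (h1 : ∀ i, ∑ k, B i k * A k i = 1) (h0 : ∀ i j, i ≠ j → ∑ k, B i k * A k j = 0) :
    Fintype.card α ≤ Fintype.card β := by
  classical
  have h : Matrix.of B * Matrix.of A = 1 := by
    ext i j
    rw [Matrix.mul_apply, Matrix.one_apply]
    split_ifs with hij
    · subst hij
      exact h1 i
    · exact h0 i j hij
  calc Fintype.card α = (Matrix.of B * Matrix.of A).rank := by rw [h, Matrix.rank_one]
    _ ≤ (Matrix.of B).rank := Matrix.rank_mul_le_left _ _
    _ ≤ Fintype.card β := Matrix.rank_le_card_width _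

/-- If the entries that link a summand of the first kind to one that is not of the second kind
compose to zero, then there are at most as many summands of the first kind as of the second. -/
lemma card_le_of_pairing {ι κ : Type} [Fintype ι] [Fintype κ] (p : ι → Prop) (p' : κ → Prop)
    (A : κ → ι → F) (B : ι → κ → F)
    (h1 : ∀ i, p i → ∑ k, B i k * A k i = 1)
    (h0 : ∀ i j, p i → p j → i ≠ j → ∑ k, B i k * A k j = 0)
    (h : ∀ i j k, p i → p j → A k j ≠ 0 → B i k ≠ 0 → p' k) :
    Nat.card {i // p i} ≤ Nat.card {k // p' k} := by
  classical
  have key (i j : ι) (hi : p i) (hj : p j) :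
      ∑ k : {k // p' k}, B i k * A k j = ∑ k, B i k * A k j := by
    rw [← Finset.sum_subtype (Finset.univ.filter p') (by simp) (fun k => B i k * A k j)]
    refine Finset.sum_filter_of_ne fun k _ hk => ?_
    exact h i j k hi hj (right_ne_zero_of_mul hk) (left_ne_zero_of_mul hk)
  rw [Nat.card_eq_fintype_card, Nat.card_eq_fintype_card]
  refine card_le_of_matrix (F := F) (fun (k : {k // p' k}) (i : {i // p i}) => A k i)
    (fun (i : {i // p i}) (k : {k // p' k}) => B i k) (fun i => ?_) (fun i j hij => ?_)
  · rw [key i i i.2 i.2, h1 i i.2]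
  · rw [key i j i.2 j.2, h0 i j i.2 j.2 (fun h => hij (Subtype.ext h))]

/-- Inserting the identity, resolved in the basis `B`, between a functional and a vector turns
composites into matrix products. All the counting arguments and the search for close entries start
here. -/
lemma BarBasis.sum_pairing {V : PersMod F T} {κ : Type} [Fintype κ] {S : κ → Set T}
    (B : BarBasis V S) {t : T} (f : V.obj t →ₗ[F] F) (v : V.obj t) :
    ∑ k, f (B.e k t) * B.f k t v = f v := by
  conv_rhs => rw [← B.total t v, map_sum]
  exact Finset.sum_congr rfl fun k _ => by rw [map_smul, smul_eq_mul, mul_comm]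

/-- A summand `J k` linked from a copy of `L` is at most `L` at both endpoints; linked back to a
copy of `L`, it is at least `L`. So only copies of `L` contribute to the identity matrix at the
index `L.birth`. -/
lemma BarBasis.card_le {V : PersMod F T} {ι κ : Type} [Fintype ι] [Fintype κ] {I : ι → Bar T}
    {J : κ → Bar T} (B : BarBasis V (fun i => (I i).toSet))
    (B' : BarBasis V (fun k => (J k).toSet)) (L : Bar T) :
    Nat.card {i // I i = L} ≤ Nat.card {k // J k = L} := by
  refine card_le_of_pairing (F := F) _ _ (fun k i => B'.f k L.birth (B.e i L.birth))
    (fun i k => B.f i L.birth (B'.e k L.birth)) (fun i hi => ?_) (fun i j hi hj hij => ?_)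
    (fun i j k hi hj h1 h2 => ?_)
  · rw [B'.sum_pairing, B.self i]
    rw [hi]
    exact L.birth_mem
  · rw [B'.sum_pairing, B.ne i j hij]
  · have h3 := le_of_pairing_ne_zero (B.isSection j) (B'.isCosection k) h1
    have h4 := le_of_pairing_ne_zero (B'.isSection k) (B.isCosection i) h2
    rw [hj] at h3
    rw [hi] at h4
    exact Bar.ext (le_antisymm h3.1 h4.1) (le_antisymm h3.2 h4.2)

section Multiset

variable {α ι κ : Type} [Fintype ι] [Fintype κ]

lemma count_univ_map [DecidableEq α] (I : ι → α) (a : α) :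
    (Finset.univ.val.map I).count a = Nat.card {i // I i = a} := by
  rw [Multiset.count_map, Nat.card_eq_fintype_card, Fintype.card_subtype]
  simp only [eq_comm]
  rfl

lemma univ_map_equiv (σ : κ ≃ ι) (I : ι → α) :
    Finset.univ.val.map (fun k => I (σ k)) = Finset.univ.val.map I := by
  rw [← Finset.map_univ_equiv σ, Finset.map_val, Multiset.map_map]
  rfl

end Multiset

variable {V : PersMod F T}

lemma IsBarcode.exists_barBasis {S : Multiset (Bar T)} (h : IsBarcode V S) :
    ∃ (n : ℕ) (J : Fin n → Bar T), Finset.univ.val.map J = S ∧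
      Nonempty (BarBasis V fun i => (J i).toSet) := by
  obtain ⟨n, J, hJ, ⟨φ⟩⟩ := h
  exact ⟨n, J, hJ, ⟨BarBasis.ofIso (fun i => intervalBasis (J i)) φ⟩⟩

lemma BarBasis.isBarcode {ι : Type} [Fintype ι] {J : ι → Bar T}
    (B : BarBasis V fun i => (J i).toSet) : IsBarcode V (Finset.univ.val.map J) := by
  let σ := (Fintype.equivFin ι).symm
  refine ⟨Fintype.card ι, fun k => J (σ k), univ_map_equiv σ J, ⟨?_⟩⟩
  exact (B.reindex σ).iso (fun i => intervalBasis (J (σ i)))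

lemma BarBasis.multiset_eq {ι κ : Type} [Fintype ι] [Fintype κ] {I : ι → Bar T} {J : κ → Bar T}
    (B : BarBasis V fun i => (I i).toSet) (B' : BarBasis V fun k => (J k).toSet) :
    Finset.univ.val.map I = Finset.univ.val.map J := by
  classical
  ext L
  rw [count_univ_map, count_univ_map]
  exact le_antisymm (B.card_le B' L) (B'.card_le B L)

/-- The barcode can be read off from any interval decomposition. -/
lemma BarBasis.barcode_eq {ι : Type} [Fintype ι] {J : ι → Bar T}
    (B : BarBasis V fun i => (J i).toSet) : barcode V = Finset.univ.val.map J := by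
  have h : ∃ S, IsBarcode V S := ⟨_, B.isBarcode⟩
  rw [barcode, dif_pos h]
  obtain ⟨n, I, hI, ⟨B'⟩⟩ := h.choose_spec.exists_barBasis
  rw [← hI]
  exact B'.multiset_eq B

lemma BarBasis.mem_barcode {ι : Type} [Fintype ι] {J : ι → Bar T}
    (B : BarBasis V fun i => (J i).toSet) (i : ι) : J i ∈ barcode V := by
  rw [B.barcode_eq]
  exact Multiset.mem_map_of_mem J (Finset.mem_univ i)

/-- The direct sum of interval decompositions. -/
noncomputable def BarBasis.sum {X Y : PersMod F T} {ι κ : Type} [Fintype ι] [Fintype κ]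
    {S : ι ⊕ κ → Set T} (B : BarBasis X fun i => S (.inl i)) (B' : BarBasis Y fun k => S (.inr k))
    (i₁ : X ⟶ V) (p₁ : V ⟶ X) (i₂ : Y ⟶ V) (p₂ : V ⟶ Y) (h11 : i₁ ≫ p₁ = 𝟙 X)
    (h12 : i₁ ≫ p₂ = 0) (h21 : i₂ ≫ p₁ = 0) (h22 : i₂ ≫ p₂ = 𝟙 Y)
    (htot : p₁ ≫ i₁ + p₂ ≫ i₂ = 𝟙 V) : BarBasis V S where
  e a t := match a with
    | .inl i => (i₁.app t).hom (B.e i t)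
    | .inr k => (i₂.app t).hom (B'.e k t)
  f a t := match a with
    | .inl i => (B.f i t).comp (p₁.app t).hom
    | .inr k => (B'.f k t).comp (p₂.app t).hom
  isSection a := match a with
    | .inl i => (B.isSection i).comp _
    | .inr k => (B'.isSection k).comp _
  isCosection a := match a with
    | .inl i => (B.isCosection i).comp _
    | .inr k => (B'.isCosection k).comp _
  self a := match a with
    | .inl i => fun t ht =>
      (congrArg (B.f i t) (hom_apply h11 (B.e i t))).trans (B.self i t ht)
    | .inr k => fun t ht =>
      (congrArg (B'.f k t) (hom_apply h22 (B'.e k t))).trans (B'.self k t ht)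
  ne a b h t := match a, b, h with
    | .inl i, .inl j, h => (congrArg (B.f i t) (hom_apply h11 (B.e j t))).trans
        (B.ne i j (fun h' => h (congrArg _ h')) t)
    | .inl i, .inr l, _ => (congrArg (B.f i t) (hom_apply h21 (B'.e l t))).trans
        (map_zero (B.f i t))
    | .inr k, .inl j, _ => (congrArg (B'.f k t) (hom_apply h12 (B.e j t))).trans
        (map_zero (B'.f k t))
    | .inr k, .inr l, h => (congrArg (B'.f k t) (hom_apply h22 (B'.e l t))).trans
        (B'.ne k l (fun h' => h (congrArg _ h')) t)
  total t v := by
    rw [Fintype.sum_sum_type]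
    have h1 := congrArg (i₁.app t).hom (B.total t ((p₁.app t).hom v))
    have h2 := congrArg (i₂.app t).hom (B'.total t ((p₂.app t).hom v))
    rw [map_sum] at h1 h2
    simp only [map_smul] at h1 h2
    exact (congrArg₂ (· + ·) h1 h2).trans (hom_apply htot v)

/-! ### Ladder decompositions, pointwise -/

namespace ElemLadder

/-- The bar in the source of an elementary ladder, if there is one. -/
def srcBar : ElemLadder T → Option (Bar T)
  | .R I _ _ => some I
  | .plus I => some I
  | .minus _ => none

/-- The bar in the target of an elementary ladder, if there is one. -/
def tgtBar : ElemLadder T → Option (Bar T)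
  | .R _ J _ => some J
  | .plus _ => none
  | .minus K => some K

/-- The unmatched bar in the source. -/
def plusBar : ElemLadder T → Option (Bar T)
  | .plus I => some I
  | _ => none

/-- The unmatched bar in the target. -/
def minusBar : ElemLadder T → Option (Bar T)
  | .minus K => some K
  | _ => none

end ElemLadder

/-- The indices in an optional bar. -/
def optSet (J : Option (Bar T)) : Set T := J.elim ∅ Bar.toSet

lemma exists_of_mem_optSet {J : Option (Bar T)} {t : T} (h : t ∈ optSet J) : ∃ L, J = some L := by
  cases J with
  | none => exact absurd h (Set.notMem_empty _)
  | some J => exact ⟨J, rfl⟩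

namespace ElemLadder

variable (F) in
/-- The basis of the source of an elementary ladder. -/
noncomputable def leftBasis :
    (E : ElemLadder T) → BarBasis (E.toArrow F).left (fun _ : Unit => optSet E.srcBar)
  | .R I _ _ => intervalBasis I
  | .plus I => intervalBasis I
  | .minus _ => zeroBasis

variable (F) in
/-- The basis of the target of an elementary ladder. -/
noncomputable def rightBasis :
    (E : ElemLadder T) → BarBasis (E.toArrow F).right (fun _ : Unit => optSet E.tgtBar)
  | .R _ J _ => intervalBasis J
  | .plus _ => zeroBasis
  | .minus K => intervalBasis K

lemma hom_basis (E : ElemLadder T) {t : T} (ht : t ∈ optSet E.srcBar) :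
    ((E.toArrow F).hom.app t).hom ((E.leftBasis F).e () t) = (E.rightBasis F).e () t := by
  cases E with
  | R I J h =>
    funext x
    exact dif_pos ht
  | plus I => rfl
  | minus K => exact absurd ht (Set.notMem_empty _)

end ElemLadder

/-- A decomposition of `Φ` into elementary ladders, given by compatible interval decompositions of
its source and its target. -/
structure LadderBasis {X Y : PersMod F T} (Φ : X ⟶ Y) {ι : Type} [Fintype ι]
    (E : ι → ElemLadder T) where
  src : BarBasis X (fun i => optSet (E i).srcBar)
  tgt : BarBasis Y (fun i => optSet (E i).tgtBar)
  map : ∀ i, ∀ t ∈ optSet (E i).srcBar, (Φ.app t).hom (src.e i t) = tgt.e i t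

namespace LadderBasis

variable {X Y : PersMod F T} {Φ : X ⟶ Y} {ι κ : Type} [Fintype ι] [Fintype κ]
  {E : ι → ElemLadder T} {E' : κ → ElemLadder T}

/-- The condition `map`, dualised: in the expansion of `v`, only the summand `i` can contribute,
since every basis vector is sent to the basis vector of the same summand. -/
lemma map_f (L : LadderBasis Φ E) (i : ι) {t : T} (ht : t ∈ optSet (E i).tgtBar)
    (v : X.obj t) : L.tgt.f i t ((Φ.app t).hom v) = L.src.f i t v := by
  classical
  conv_lhs => rw [← L.src.total t v]
  rw [map_sum, map_sum, Finset.sum_eq_single i]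
  · rw [map_smul, map_smul, smul_eq_mul]
    by_cases hs : t ∈ optSet (E i).srcBar
    · rw [L.map i t hs, L.tgt.self i t ht, mul_one]
    · rw [(L.src.isCosection i).zero t hs]
      simp
  · intro j _ hj
    rw [map_smul, map_smul]
    by_cases hs : t ∈ optSet (E j).srcBar
    · rw [L.map j t hs, L.tgt.ne i j hj.symm, smul_zero]
    · rw [(L.src.isCosection j).zero t hs]
      simp
  · simp

/-- Reindexes a ladder decomposition. -/
noncomputable def reindex (L : LadderBasis Φ E) (σ : κ ≃ ι) :
    LadderBasis Φ (fun k => E (σ k)) where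
  src := L.src.reindex σ
  tgt := L.tgt.reindex σ
  map k := L.map (σ k)

lemma isLadderDecomposition (L : LadderBasis Φ E) :
    IsLadderDecomposition Φ (Finset.univ.val.map E) := by
  let σ := (Fintype.equivFin ι).symm
  refine ⟨Fintype.card ι, fun k => E (σ k), univ_map_equiv σ E, ⟨?_⟩⟩
  let M := L.reindex σ
  refine Arrow.isoMk (M.src.iso fun i => (E (σ i)).leftBasis F)
    (M.tgt.iso fun i => (E (σ i)).rightBasis F) ?_
  refine biproduct.hom_ext _ _ fun i => ?_
  have h1 : (M.src.iso fun i => (E (σ i)).leftBasis F).hom ≫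
      biproduct.map (fun i => ((E (σ i)).toArrow F).hom) ≫ biproduct.π _ i =
      M.src.toHom i (((E (σ i)).leftBasis F).isSection ()) ≫ ((E (σ i)).toArrow F).hom := by
    rw [biproduct.map_π, ← Category.assoc, BarBasis.iso_hom_π]
  have h2 : Φ ≫ (M.tgt.iso fun i => (E (σ i)).rightBasis F).hom ≫ biproduct.π _ i =
      Φ ≫ M.tgt.toHom i (((E (σ i)).rightBasis F).isSection ()) := by
    rw [BarBasis.iso_hom_π]
  refine (Category.assoc _ _ _).trans (h1.trans (Eq.trans ?_ (h2.symm.trans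
    (Category.assoc _ _ _).symm)))
  refine hom_ext_apply fun t v => ?_
  change (((E (σ i)).toArrow F).hom.app t).hom
    (M.src.f i t v • ((E (σ i)).leftBasis F).e () t) =
    M.tgt.f i t ((Φ.app t).hom v) • ((E (σ i)).rightBasis F).e () t
  rw [map_smul]
  by_cases hs : t ∈ optSet (E (σ i)).srcBar
  · rw [ElemLadder.hom_basis _ hs]
    by_cases ht : t ∈ optSet (E (σ i)).tgtBar
    · rw [M.map_f i ht]
    · rw [(((E (σ i)).rightBasis F).isSection ()).zero t ht, smul_zero, smul_zero]
  · rw [(M.src.isCosection i).zero t hs, LinearMap.zero_apply, zero_smul]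
    by_cases ht : t ∈ optSet (E (σ i)).tgtBar
    · rw [M.map_f i ht, (M.src.isCosection i).zero t hs, LinearMap.zero_apply, zero_smul]
    · rw [(((E (σ i)).rightBasis F).isSection ()).zero t ht, smul_zero]

end LadderBasis

lemma IsLadderDecomposition.exists_ladderBasis {X Y : PersMod F T} {Φ : X ⟶ Y}
    {D : Multiset (ElemLadder T)} (h : IsLadderDecomposition Φ D) :
    ∃ (n : ℕ) (E : Fin n → ElemLadder T), Finset.univ.val.map E = D ∧
      Nonempty (LadderBasis Φ E) := by
  obtain ⟨n, E, hE, ⟨φ⟩⟩ := h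
  let α : X ≅ ⨁ fun i => ((E i).toArrow F).left := Arrow.leftFunc.mapIso φ
  let β : Y ≅ ⨁ fun i => ((E i).toArrow F).right := Arrow.rightFunc.mapIso φ
  have hw : α.inv ≫ Φ = biproduct.map (fun i => ((E i).toArrow F).hom) ≫ β.inv := Arrow.w φ.inv
  refine ⟨n, E, hE, ⟨⟨BarBasis.ofIso (fun i => (E i).leftBasis F) α,
    BarBasis.ofIso (fun i => (E i).rightBasis F) β, fun i t ht => ?_⟩⟩⟩
  have h2 : (biproduct.ι (fun i => ((E i).toArrow F).left) i ≫ α.inv) ≫ Φ =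
      ((E i).toArrow F).hom ≫ biproduct.ι (fun i => ((E i).toArrow F).right) i ≫ β.inv := by
    rw [Category.assoc, hw, ← Category.assoc, biproduct.ι_map, Category.assoc]
  refine (hom_apply h2 (((E i).leftBasis F).e () t)).trans ?_
  exact congrArg ((biproduct.ι (fun i => ((E i).toArrow F).right) i ≫ β.inv).app t).hom
    (ElemLadder.hom_basis (E i) ht)

/-! ### Uniqueness of the induced matching -/

lemma le_of_pairing_ne_zero_opt {V : PersMod F T} {e : ∀ t, V.obj t} {f : ∀ t, V.obj t →ₗ[F] F}
    {I J : Option (Bar T)} (he : IsSection V (optSet I) e) (hf : IsCosection V (optSet J) f) {t : T}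
    (h : f t (e t) ≠ 0) :
    ∃ I' J', I = some I' ∧ J = some J' ∧ J'.birth ≤ I'.birth ∧ J'.death ≤ I'.death := by
  obtain ⟨hI, hJ⟩ := mem_of_pairing_ne_zero he hf h
  obtain ⟨I', rfl⟩ := exists_of_mem_optSet hI
  obtain ⟨J', rfl⟩ := exists_of_mem_optSet hJ
  exact ⟨I', J', rfl, rfl, le_of_pairing_ne_zero he hf h⟩

namespace LadderBasis

variable {X Y : PersMod F T} {Φ : X ⟶ Y} {ι κ : Type} [Fintype ι] [Fintype κ]
  {E : ι → ElemLadder T} {E' : κ → ElemLadder T}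

lemma overlaps_of_eq {E : ElemLadder T} {I J : Bar T} (hI : E.srcBar = some I)
    (hJ : E.tgtBar = some J) : ∃ h, E = .R I J h := by
  cases E with
  | R I' J' h =>
    cases hI
    cases hJ
    exact ⟨h, rfl⟩
  | plus I' => cases hJ
  | minus K => cases hI

/-- The squeeze of `BarBasis.card_le` is applied twice, to the bars in the source and, with the same
scalars, to the bars in the target. -/
lemma card_le (L : LadderBasis Φ E) (L' : LadderBasis Φ E') (I J : Bar T) :
    Nat.card {i // (E i).srcBar = some I ∧ (E i).tgtBar = some J} ≤
      Nat.card {k // (E' k).srcBar = some I ∧ (E' k).tgtBar = some J} := by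
  refine card_le_of_pairing (F := F) _ _ (fun k i => L'.src.f k I.birth (L.src.e i I.birth))
    (fun i k => L.src.f i I.birth (L'.src.e k I.birth)) (fun i hi => ?_) (fun i j hi hj hij => ?_)
    (fun i j k hi hj h1 h2 => ?_)
  · rw [L'.src.sum_pairing, L.src.self i]
    rw [hi.1]
    exact I.birth_mem
  · rw [L'.src.sum_pairing, L.src.ne i j hij]
  · have hI {a : Option (Bar T)} (ha : a = some I) : I.birth ∈ optSet a := ha ▸ I.birth_mem
    obtain ⟨h, -⟩ := overlaps_of_eq hi.1 hi.2
    obtain ⟨ho, -⟩ := overlaps_of_eq hi.1 hi.2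
    have hJ {a : Option (Bar T)} (ha : a = some J) : I.birth ∈ optSet a := by
      subst ha
      exact ⟨ho.1, ho.2.1⟩
    obtain ⟨A, B, hA, hB, h3⟩ := le_of_pairing_ne_zero_opt (L.src.isSection j)
      (L'.src.isCosection k) h1
    obtain ⟨B', A', hB', hA', h4⟩ := le_of_pairing_ne_zero_opt (L'.src.isSection k)
      (L.src.isCosection i) h2
    have hk := (mem_of_pairing_ne_zero (L.src.isSection j) (L'.src.isCosection k) h1).2
    obtain rfl : A = I := by simpa [hj.1] using hA.symm
    obtain rfl : A' = A := by simpa [hi.1] using hA'.symm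
    obtain rfl : B' = B := by simpa [hB] using hB'.symm
    obtain rfl : B' = A' := Bar.ext (le_antisymm h3.1 h4.1) (le_antisymm h3.2 h4.2)
    refine ⟨hB, ?_⟩
    -- Because `J ≼ I`, the index `I.birth` lies in `J` as well. Both decompositions are compatible
    -- with `Φ`, so the nonzero pairings in the source are also pairings in the target.
    rw [← L.map_f i (hJ hi.2), L'.map k _ hk] at h2
    obtain ⟨B₁, A₁, hB₁, hA₁, h5⟩ := le_of_pairing_ne_zero_opt (L'.tgt.isSection k)
      (L.tgt.isCosection i) h2
    have hk' := (mem_of_pairing_ne_zero (L'.tgt.isSection k) (L.tgt.isCosection i) h2).1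
    rw [← L'.map_f k hk', L.map j _ (hI hj.1)] at h1
    obtain ⟨A₂, B₂, hA₂, hB₂, h6⟩ := le_of_pairing_ne_zero_opt (L.tgt.isSection j)
      (L'.tgt.isCosection k) h1
    obtain rfl : A₁ = J := by simpa [hi.2] using hA₁.symm
    obtain rfl : A₂ = A₁ := by simpa [hj.2] using hA₂.symm
    obtain rfl : B₂ = B₁ := by simpa [hB₁] using hB₂.symm
    rw [hB₁, Bar.ext (le_antisymm h5.1 h6.1) (le_antisymm h5.2 h6.2)]

end LadderBasis

/-! ### Multiplicities in induced matchings -/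

section Multiset

variable {α β ι : Type} [Fintype ι]

lemma count_filterMap_univ [DecidableEq β] (E : ι → α) (g : α → Option β) (b : β) :
    ((Finset.univ.val.map E).filterMap g).count b = Nat.card {i // g (E i) = some b} := by
  classical
  have h (s : Multiset α) : (s.filterMap g).count b = s.countP (fun a => g a = some b) := by
    induction s using Multiset.induction with
    | empty => simp
    | cons a s ih =>
      rw [Multiset.countP_cons, ← ih]
      cases hg : g a with
      | none => rw [Multiset.filterMap_cons_none _ _ hg]; simp
      | some c =>
        rw [Multiset.filterMap_cons_some _ _ _ hg, Multiset.count_cons]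
        simp [eq_comm]
  rw [h, Multiset.countP_map, Nat.card_eq_fintype_card, Fintype.card_subtype]
  rfl

end Multiset

lemma count_matchingOf {ι : Type} [Fintype ι] (E : ι → ElemLadder T) (d : T) (I J : Bar T) :
    (matchingOf d (Finset.univ.val.map E)).count (I, J.translate d) =
      Nat.card {i // (E i).srcBar = some I ∧ (E i).tgtBar = some J} := by
  classical
  have h (E : ElemLadder T) : (match E with
      | .R I J _ => some (I, J.translate d)
      | .plus _ => none
      | .minus _ => none) = some (I, J.translate d) ↔
      E.srcBar = some I ∧ E.tgtBar = some J := by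
    have hinj (J' : Bar T) : J'.translate d = J.translate d ↔ J' = J := by
      refine ⟨fun h => ?_, fun h => h ▸ rfl⟩
      rw [← Bar.translate_translate J' (add_neg_cancel d), h,
        Bar.translate_translate J (add_neg_cancel d)]
    cases E <;> simp [ElemLadder.srcBar, ElemLadder.tgtBar, hinj]
  rw [matchingOf]
  have := count_filterMap_univ E (fun E : ElemLadder T => match E with
      | .R I J _ => some (I, J.translate d)
      | .plus _ => none
      | .minus _ => none) (I, J.translate d)
  simp only [h] at this
  refine Eq.trans ?_ this
  congr

/-- The matching induced by a ladder decomposition does not depend on the decomposition. -/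
lemma LadderBasis.inducesMatching {X Y : PersMod F T} {d : T} {Φ : X ⟶ (shift d).obj Y}
    {ι : Type} [Fintype ι] {E : ι → ElemLadder T} (L : LadderBasis Φ E) :
    InducesMatching d Φ (matchingOf d (Finset.univ.val.map E)) := by
  classical
  refine ⟨⟨_, L.isLadderDecomposition⟩, fun D hD => ?_⟩
  obtain ⟨n, E', rfl, ⟨L'⟩⟩ := hD.exists_ladderBasis
  ext ⟨I, J⟩
  rw [← Bar.translate_translate J (neg_add_cancel d), count_matchingOf, count_matchingOf]
  exact le_antisymm (L'.card_le L _ _) (L.card_le L' _ _)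

/-! ### Barcodes of the source and the target -/

/-- Summands without a bar have zero basis vectors, so omitting them leaves an interval
decomposition. -/
lemma BarBasis.barcode_eq_filterMap {V : PersMod F T} {ι : Type} [Fintype ι]
    {J : ι → Option (Bar T)} (B : BarBasis V fun i => optSet (J i)) :
    barcode V = (Finset.univ.val.map J).filterMap id := by
  classical
  let K : {i // (J i).isSome} → Bar T := fun i => (J i).get i.2
  have hK (i : {i // (J i).isSome}) : optSet (J i) = (K i).toSet := by
    rw [← Option.some_get i.2]
    rfl
  have hz (i : ι) (hi : ¬ (J i).isSome) (t : T) : t ∉ optSet (J i) := by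
    rw [Option.not_isSome_iff_eq_none] at hi
    rw [hi]
    exact Set.notMem_empty t
  let B' : BarBasis V fun i => (K i).toSet :=
    { e := fun i => B.e i
      f := fun i => B.f i
      isSection := fun i => hK i ▸ B.isSection i
      isCosection := fun i => hK i ▸ B.isCosection i
      self := fun i t ht => B.self i t (hK i ▸ ht)
      ne := fun i j h => B.ne i j (fun h' => h (Subtype.ext h'))
      total := fun t v => by
        rw [← Finset.sum_subtype (Finset.univ.filter fun i => (J i).isSome) (by simp)
          (fun i => B.f i t v • B.e i t)]
        refine (Finset.sum_filter_of_ne fun i _ hi => ?_).trans (B.total t v)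
        by_contra h
        exact hi (by rw [(B.isSection i).zero t (hz i h t), smul_zero]) }
  rw [B'.barcode_eq]
  ext L
  rw [count_univ_map, count_filterMap_univ]
  refine Nat.card_congr ⟨fun i => ⟨i.1.1, ?_⟩, fun i => ⟨⟨i.1, ?_⟩, ?_⟩, fun i => rfl, fun i => rfl⟩
  · exact (Option.some_get i.1.2).symm.trans (congrArg some i.2)
  · rw [show J i.1 = some L from i.2]
    rfl
  · have := i.2
    simp only [id] at this
    simp [K, this]

lemma BarBasis.exists_shift {V : PersMod F T} {ι : Type} [Fintype ι] {J : ι → Bar T}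
    (B : BarBasis V fun i => (J i).toSet) (d : T) :
    Nonempty (BarBasis ((PersLadder.shift d).obj V) fun i => ((J i).translate (-d)).toSet) := by
  have := B.shift d
  simp only [Bar.preimage_add] at this
  exact ⟨this⟩

lemma FinitelyIndexed.barcode_shift {V : PersMod F T} (hV : FinitelyIndexed V) (d : T) :
    (barcode ((shift d).obj V)).map (fun J => J.translate d) = barcode V := by
  obtain ⟨ι, _, J, ⟨B⟩⟩ := hV.exists_barBasis
  obtain ⟨B'⟩ := B.exists_shift d
  rw [B'.barcode_eq, B.barcode_eq, Multiset.map_map]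
  refine Multiset.map_congr rfl fun i _ => ?_
  exact Bar.translate_translate (J i) (neg_add_cancel d)

lemma filterMap_srcBar (d : T) (D : Multiset (ElemLadder T)) :
    D.filterMap ElemLadder.srcBar =
      (matchingOf d D).map Prod.fst + D.filterMap ElemLadder.plusBar := by
  induction D using Multiset.induction with
  | empty => rfl
  | cons E D ih =>
    rw [matchingOf] at ih ⊢
    cases E <;>
      simp only [Multiset.filterMap_cons, ElemLadder.srcBar, ElemLadder.plusBar,
        Option.map_some, Option.map_none, Option.getD_some, Option.getD_none, Multiset.map_add,
        Multiset.map_singleton, zero_add, ih, add_assoc, add_left_comm]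

lemma filterMap_tgtBar (d : T) (D : Multiset (ElemLadder T)) :
    (D.filterMap ElemLadder.tgtBar).map (fun J => J.translate d) =
      (matchingOf d D).map Prod.snd +
        (D.filterMap ElemLadder.minusBar).map (fun J => J.translate d) := by
  induction D using Multiset.induction with
  | empty => rfl
  | cons E D ih =>
    rw [matchingOf] at ih ⊢
    cases E <;>
      simp only [Multiset.filterMap_cons, ElemLadder.tgtBar, ElemLadder.minusBar,
        Option.map_some, Option.map_none, Option.getD_some, Option.getD_none, Multiset.map_add,
        Multiset.map_singleton, zero_add, ih, add_assoc, add_left_comm]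

/-! ### Interleavings, pointwise -/

section Interleaving

variable {V W : PersMod F T} {d : T}

/-- The components of a morphism to a shifted module. -/
noncomputable def ap (Φ : V ⟶ (shift d).obj W) (t : T) : V.obj t →ₗ[F] W.obj (t + d) :=
  (Φ.app t).hom

lemma ap_tr (Φ : V ⟶ (shift d).obj W) {s t : T} (h : s ≤ t) (v : V.obj s) :
    ap Φ t (tr V h v) = tr W (add_le_add_left h d) (ap Φ s v) :=
  app_tr Φ h v

lemma IsSection.ap {S : Set T} {e : ∀ t, V.obj t} (he : IsSection V S e)
    (Φ : V ⟶ (PersLadder.shift d).obj W) :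
    IsSection ((PersLadder.shift d).obj W) S (fun t => PersLadder.ap Φ t (e t)) :=
  he.comp Φ

lemma IsSection.shift_bar {J : Bar T} {e : ∀ t, V.obj t} (he : IsSection V J.toSet e) (d : T) :
    IsSection ((PersLadder.shift d).obj V) (J.translate (-d)).toSet (fun t => e (t + d)) := by
  rw [← Bar.preimage_add]
  exact he.shift d

lemma IsCosection.shift_bar {J : Bar T} {f : ∀ t, V.obj t →ₗ[F] F} (hf : IsCosection V J.toSet f)
    (d : T) :
    IsCosection ((PersLadder.shift d).obj V) (J.translate (-d)).toSet (fun t => f (t + d)) := by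
  rw [← Bar.preimage_add]
  exact hf.shift d

lemma ap_pairing_eq (Φ : V ⟶ (shift d).obj W) {S S' : Set T} {e : ∀ t, V.obj t}
    {f : ∀ t, W.obj t →ₗ[F] F} (he : IsSection V S e) (hf : IsCosection W S' f) {s t : T}
    (h : s ≤ t) (hs : s ∈ S) (ht : t + d ∈ S') :
    f (t + d) (ap Φ t (e t)) = f (s + d) (ap Φ s (e s)) :=
  pairing_eq (he.ap Φ) (hf.shift d) h hs ht

lemma mem_of_ap_ne_zero (Φ : V ⟶ (shift d).obj W) {S S' : Set T} {e : ∀ t, V.obj t}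
    {f : ∀ t, W.obj t →ₗ[F] F} (he : IsSection V S e) (hf : IsCosection W S' f) {t : T}
    (h : f (t + d) (ap Φ t (e t)) ≠ 0) : t ∈ S ∧ t + d ∈ S' :=
  mem_of_pairing_ne_zero (he.ap Φ) (hf.shift d) h

lemma le_of_ap_ne_zero (Φ : V ⟶ (shift d).obj W) {I J : Bar T} {e : ∀ t, V.obj t}
    {f : ∀ t, W.obj t →ₗ[F] F} (he : IsSection V I.toSet e) (hf : IsCosection W J.toSet f) {t : T}
    (h : f (t + d) (ap Φ t (e t)) ≠ 0) :
    J.birth ≤ I.birth + d ∧ J.death ≤ I.death + d := by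
  have := le_of_pairing_ne_zero (he.ap Φ) (hf.shift_bar d) h
  simp only [Bar.translate] at this
  constructor <;> grind

lemma le_add_add (hd : 0 ≤ d) (t : T) : t ≤ t + d + d := by grind

/-- The interleaving relations, on elements. -/
def Interleaved (hd : 0 ≤ d) (Φ : V ⟶ (shift d).obj W) (Ψ : W ⟶ (shift d).obj V) : Prop :=
  (∀ t v, ap Ψ (t + d) (ap Φ t v) = tr V (le_add_add hd t) v) ∧
  (∀ t v, ap Φ (t + d) (ap Ψ t v) = tr W (le_add_add hd t) v)

lemma Interleaved.symm {hd : 0 ≤ d} {Φ : V ⟶ (shift d).obj W} {Ψ : W ⟶ (shift d).obj V}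
    (h : Interleaved hd Φ Ψ) : Interleaved hd Ψ Φ := ⟨h.2, h.1⟩

lemma tr_injective_of_ge (V : PersMod F T) {s t : T} (h : s ≤ t) (h' : t ≤ s) :
    Function.Injective (tr V h) := by
  intro v w hvw
  have := congrArg (tr V h') hvw
  simpa [tr_tr] using this

/-- The indices `t + d + d` and `t + (d + d)` are equal only propositionally. The inner map between
them is injective, so it can be cancelled. -/
lemma interleaving_half_iff (hd : 0 ≤ d) (Φ : V ⟶ (shift d).obj W) (Ψ : W ⟶ (shift d).obj V) :
    Φ ≫ (shift d).map Ψ ≫ regroup V d d (d + d) rfl = innerMap V (d + d) (add_nonneg hd hd) ↔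
    ∀ t v, ap Ψ (t + d) (ap Φ t v) = tr V (le_add_add hd t) v := by
  have hle (t : T) : t + d + d ≤ t + (d + d) := (add_assoc t d d).le
  have hl (t : T) (v : V.obj t) :
      ((Φ ≫ (shift d).map Ψ ≫ regroup V d d (d + d) rfl).app t).hom v =
        tr V (hle t) (ap Ψ (t + d) (ap Φ t v)) := rfl
  have hr (t : T) (v : V.obj t) : ((innerMap V (d + d) (add_nonneg hd hd)).app t).hom v =
      tr V (hle t) (tr V (le_add_add hd t) v) := by
    rw [tr_tr]
    rfl
  constructor
  · intro h t v
    refine tr_injective_of_ge V (hle t) (add_assoc t d d).ge ?_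
    rw [← hl, ← hr, h]
  · intro h
    refine hom_ext_apply fun t v => ?_
    rw [hl, h, hr]

lemma isInterleaving_iff (hd : 0 ≤ d) (Φ : V ⟶ (shift d).obj W) (Ψ : W ⟶ (shift d).obj V) :
    IsInterleaving d hd Φ Ψ ↔ Interleaved hd Φ Ψ :=
  and_congr (interleaving_half_iff hd Φ Ψ) (interleaving_half_iff hd Ψ Φ)

end Interleaving

/-! ### The matrix of a morphism -/

section Matrix

variable {V W : PersMod F T} {d : T} {ι κ : Type} [Fintype ι] [Fintype κ] {I : ι → Bar T}
  {J : κ → Bar T}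

/-- The matrix entries of a morphism between decomposed modules. -/
noncomputable def entry (Φ : V ⟶ (shift d).obj W) (B : BarBasis V fun i => (I i).toSet)
    (C : BarBasis W fun j => (J j).toSet) (j : κ) (i : ι) : F :=
  C.f j ((I i).birth + d) (ap Φ (I i).birth (B.e i (I i).birth))

variable (Φ : V ⟶ (shift d).obj W) (Ψ : W ⟶ (shift d).obj V)
  (B : BarBasis V fun i => (I i).toSet) (C : BarBasis W fun j => (J j).toSet)

lemma entry_eq {t : T} {i : ι} {j : κ} (hi : t ∈ (I i).toSet) (hj : t + d ∈ (J j).toSet) :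
    C.f j (t + d) (ap Φ t (B.e i t)) = entry Φ B C j i :=
  ap_pairing_eq Φ (B.isSection i) (C.isCosection j) hi.1 (I i).birth_mem hj

lemma entry_eq_of_ne_zero {t : T} {i : ι} {j : κ} (h : C.f j (t + d) (ap Φ t (B.e i t)) ≠ 0) :
    C.f j (t + d) (ap Φ t (B.e i t)) = entry Φ B C j i :=
  have := mem_of_ap_ne_zero Φ (B.isSection i) (C.isCosection j) h
  entry_eq Φ B C this.1 this.2

lemma entry_ne_zero {i : ι} {j : κ} (h : entry Φ B C j i ≠ 0) :
    (J j).birth ≤ (I i).birth + d ∧ (I i).birth + d ≤ (J j).death ∧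
      (J j).death ≤ (I i).death + d := by
  have h1 := mem_of_ap_ne_zero Φ (B.isSection i) (C.isCosection j) h
  have h2 := le_of_ap_ne_zero Φ (B.isSection i) (C.isCosection j) h
  exact ⟨h2.1, h1.2.2, h2.2⟩

lemma ap_eq_zero (h : ∀ j i, entry Φ B C j i = 0) (t : T) (v : V.obj t) : ap Φ t v = 0 := by
  rw [← B.total t v, map_sum]
  refine Finset.sum_eq_zero fun i _ => ?_
  rw [map_smul, ← C.total (t + d) (ap Φ t (B.e i t))]
  rw [Finset.sum_eq_zero fun j _ => ?_, smul_zero]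
  by_cases h0 : C.f j (t + d) (ap Φ t (B.e i t)) = 0
  · rw [h0, zero_smul]
  · exact absurd ((entry_eq_of_ne_zero Φ B C h0).trans (h j i)) h0

variable {Φ Ψ} {hd : 0 ≤ d}

/-- A long bar of the source is linked to a close bar of the target. -/
lemma exists_entry_of_long_source (h : Interleaved hd Φ Ψ) {i : ι}
    (hi : (I i).birth + d + d ≤ (I i).death) :
    ∃ j, entry Φ B C j i ≠ 0 ∧ (I i).birth ≤ (J j).birth + d ∧ (I i).death ≤ (J j).death + d := by
  set t := (I i).birth
  -- The diagonal entry of the inner map over `2d` at a long bar is `1`. Expanded over the bars of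
  -- `W`, some term is nonzero; its factor from `Φ` is the entry, and its factor from `Ψ` gives the
  -- closeness.
  have h1 : ∑ j, ((B.f i (t + d + d)).comp (ap Ψ (t + d))) (C.e j (t + d)) *
      C.f j (t + d) (ap Φ t (B.e i t)) = 1 := by
    rw [C.sum_pairing, LinearMap.comp_apply, h.1, (B.isSection i).map _ (I i).birth_mem]
    exact B.self i _ ⟨le_add_add hd t, hi⟩
  obtain ⟨j, -, hj⟩ := Finset.exists_ne_zero_of_sum_ne_zero (h1.trans_ne one_ne_zero)
  exact ⟨j, right_ne_zero_of_mul hj,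
    le_of_ap_ne_zero Ψ (C.isSection j) (B.isCosection i) (left_ne_zero_of_mul hj)⟩

/-- A long bar of the target is linked to a close bar of the source. -/
lemma exists_entry_of_long_target (h : Interleaved hd Φ Ψ) {j : κ}
    (hj : (J j).birth + d + d ≤ (J j).death) :
    ∃ i, entry Φ B C j i ≠ 0 ∧ (I i).birth ≤ (J j).birth + d ∧ (I i).death ≤ (J j).death + d := by
  set t := (J j).birth
  have h1 : ∑ i, ((C.f j (t + d + d)).comp (ap Φ (t + d))) (B.e i (t + d)) *
      B.f i (t + d) (ap Ψ t (C.e j t)) = 1 := by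
    rw [B.sum_pairing, LinearMap.comp_apply, h.2, (C.isSection j).map _ (J j).birth_mem]
    exact C.self j _ ⟨le_add_add hd t, hj⟩
  obtain ⟨i, -, hi⟩ := Finset.exists_ne_zero_of_sum_ne_zero (h1.trans_ne one_ne_zero)
  refine ⟨i, ?_, le_of_ap_ne_zero Ψ (C.isSection j) (B.isCosection i) (right_ne_zero_of_mul hi)⟩
  rw [← entry_eq_of_ne_zero Φ B C (left_ne_zero_of_mul hi)]
  exact left_ne_zero_of_mul hi

/-- Strictly nested bars differ by more than `r` at both endpoints. -/
def Separated {ι : Type} (r : T) (I : ι → Bar T) : Prop :=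
  ∀ i i', (I i).StrictlyNested (I i') →
    r < (I i).birth - (I i').birth ∧ r < (I i').death - (I i).death

/-- Strict nesting is the only way in which two bars can fail to be comparable endpointwise, hence
the only obstruction to clearing rows and columns. -/
lemma le_or_nested (A B : Bar T) : (A.birth ≤ B.birth ∧ A.death ≤ B.death) ∨
    (B.birth ≤ A.birth ∧ B.death ≤ A.death ∧ A ≠ B) ∨ A.StrictlyNested B ∨ B.StrictlyNested A := by
  simp only [Bar.StrictlyNested]
  by_cases h : A = B
  · subst h
    simp
  · simp only [ne_eq, h, not_false_eq_true, and_true]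
    grind

lemma lt_add_of_le_of_ne {A B : Bar T} (h1 : B.birth ≤ A.birth) (h2 : B.death ≤ A.death)
    (h : A ≠ B) : B.birth + B.death < A.birth + A.death := by
  by_contra hlt
  exact h (Bar.ext (by grind) (by grind))

/-- There is a nonzero matrix entry whose row and column can be cleared by changes of bases. -/
lemma exists_pivot (h : Interleaved hd Φ Ψ) (hI : Separated (d + d) I) (hJ : Separated (d + d) J)
    (hne : ∃ j i, entry Φ B C j i ≠ 0) :
    ∃ j₀ i₀, entry Φ B C j₀ i₀ ≠ 0 ∧
      (∀ j, entry Φ B C j i₀ ≠ 0 → (J j).birth ≤ (J j₀).birth ∧ (J j).death ≤ (J j₀).death) ∧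
      (∀ i, entry Φ B C j₀ i ≠ 0 → (I i₀).birth ≤ (I i).birth ∧ (I i₀).death ≤ (I i).death) := by
  classical
  -- These are the inequalities opposite to those that a nonzero entry forces; together they place
  -- the bars within distance `d`.
  let close (j : κ) (i : ι) : Prop :=
    (I i).birth ≤ (J j).birth + d ∧ (I i).death ≤ (J j).death + d
  -- The pivot is sought among nonzero entries with a property `Q` that survives making `I` smaller
  -- or `J` larger, and that rules out nesting in the row and the column of such an entry.
  obtain ⟨Q, ⟨j₁, i₁, h₁, hQ₁⟩, hQ, hQI, hQJ⟩ : ∃ Q : κ → ι → Prop,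
      (∃ j i, entry Φ B C j i ≠ 0 ∧ Q j i) ∧
      (∀ j i j' i', Q j i → (I i').birth ≤ (I i).birth → (I i').death ≤ (I i).death →
        (J j).birth ≤ (J j').birth → (J j).death ≤ (J j').death → Q j' i') ∧
      (∀ j i i', entry Φ B C j i ≠ 0 → entry Φ B C j i' ≠ 0 → Q j i →
        ¬ (I i).StrictlyNested (I i') ∧ ¬ (I i').StrictlyNested (I i)) ∧
      (∀ j j' i, entry Φ B C j i ≠ 0 → entry Φ B C j' i ≠ 0 → Q j i →
        ¬ (J j).StrictlyNested (J j') ∧ ¬ (J j').StrictlyNested (J j)) := by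
    by_cases hc : ∃ j i, entry Φ B C j i ≠ 0 ∧ close j i
    · refine ⟨close, hc, ?_, fun j i i' h1 h2 h3 => ?_, fun j j' i h1 h2 h3 => ?_⟩
      · intro j i j' i' h0 h1 h2 h3 h4
        exact ⟨by have := h0.1; grind, by have := h0.2; grind⟩
      -- Closeness of one entry and nonvanishing of the other give `I i ≤ I i' + 2d` at both
      -- endpoints. The births contradict one nesting and the deaths the other. The column is
      -- treated in the same way.
      · have e1 := entry_ne_zero Φ B C h1
        have e2 := entry_ne_zero Φ B C h2
        obtain ⟨c1, c2⟩ := h3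
        constructor
        · intro hn
          have := hI _ _ hn
          grind
        · intro hn
          have := hI _ _ hn
          grind
      · have e1 := entry_ne_zero Φ B C h1
        have e2 := entry_ne_zero Φ B C h2
        obtain ⟨c1, c2⟩ := h3
        constructor
        · intro hn
          have := hJ _ _ hn
          grind
        · intro hn
          have := hJ _ _ hn
          grind
    -- The outer bar of a nested pair has length greater than `4d`, so it would have a close nonzero
    -- entry. Without such entries there is no nesting at all, and every nonzero entry is
    -- admissible.
    · have hnI (i i' : ι) : ¬ (I i).StrictlyNested (I i') := by
        intro hn
        have h1 := hI _ _ hn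
        have h2 := (I i).le
        obtain ⟨j, hj⟩ := exists_entry_of_long_source B C h (i := i') (by grind)
        exact hc ⟨j, i', hj⟩
      have hnJ (j j' : κ) : ¬ (J j).StrictlyNested (J j') := by
        intro hn
        have h1 := hJ _ _ hn
        have h2 := (J j).le
        obtain ⟨i, hi⟩ := exists_entry_of_long_target B C h (j := j') (by grind)
        exact hc ⟨j', i, hi⟩
      obtain ⟨j, i, hji⟩ := hne
      exact ⟨fun _ _ => True, ⟨j, i, hji, trivial⟩, fun _ _ _ _ _ _ _ _ _ => trivial,
        fun _ _ _ _ _ _ => ⟨hnI _ _, hnI _ _⟩, fun _ _ _ _ _ _ => ⟨hnJ _ _, hnJ _ _⟩⟩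
  -- A competitor that compares in the wrong direction would have a smaller `I` or a larger `J`,
  -- still satisfy `Q`, and lower this quantity.
  obtain ⟨⟨j₀, i₀⟩, hmem, hmin⟩ := Finset.exists_min_image
    (Finset.univ.filter fun p : κ × ι => entry Φ B C p.1 p.2 ≠ 0 ∧ Q p.1 p.2)
    (fun p => (I p.2).birth + (I p.2).death - ((J p.1).birth + (J p.1).death))
    ⟨(j₁, i₁), by simp [h₁, hQ₁]⟩
  simp only [Finset.mem_filter, Finset.mem_univ, true_and] at hmem hmin
  refine ⟨j₀, i₀, hmem.1, fun j hj => ?_, fun i hi => ?_⟩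
  · have hn := hQJ _ _ _ hmem.1 hj hmem.2
    rcases le_or_nested (J j) (J j₀) with h1 | h1 | h1 | h1
    · exact h1
    · have h2 := hmin (j, i₀) ⟨hj, hQ _ _ _ _ hmem.2 le_rfl le_rfl h1.1 h1.2.1⟩
      have h3 := lt_add_of_le_of_ne h1.1 h1.2.1 h1.2.2
      exfalso
      simp only at h2
      grind
    · exact absurd h1 hn.2
    · exact absurd h1 hn.1
  · have hn := hQI _ _ _ hmem.1 hi hmem.2
    rcases le_or_nested (I i₀) (I i) with h1 | h1 | h1 | h1
    · exact h1
    · have h2 := hmin (j₀, i) ⟨hi, hQ _ _ _ _ hmem.2 h1.1 h1.2.1 le_rfl le_rfl⟩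
      have h3 := lt_add_of_le_of_ne h1.1 h1.2.1 h1.2.2
      exfalso
      simp only at h2
      grind
    · exact absurd h1 hn.1
    · exact absurd h1 hn.2

end Matrix

/-! ### Splitting off an elementary ladder -/

/-- An elementary summand `R^I_{J(d)}` of a morphism `Φ : V ⟶ W(d)`. -/
structure LadderSummand {V W : PersMod F T} {d : T} (Φ : V ⟶ (shift d).obj W) where
  I : Bar T
  J : Bar T
  overlaps : (J.translate (-d)).Overlaps I
  e : ∀ t, V.obj t
  f : ∀ t, V.obj t →ₗ[F] F
  g : ∀ t, W.obj t
  h : ∀ t, W.obj t →ₗ[F] F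
  he : IsSection V I.toSet e
  hf : IsCosection V I.toSet f
  hg : IsSection W J.toSet g
  hh : IsCosection W J.toSet h
  fe : ∀ t ∈ I.toSet, f t (e t) = 1
  hg' : ∀ t ∈ J.toSet, h t (g t) = 1
  map_e : ∀ t ∈ I.toSet, ap Φ t (e t) = g (t + d)
  map_f : ∀ t, t + d ∈ J.toSet → ∀ v, h (t + d) (ap Φ t v) = f t v

open Classical in
/-- A pivot gives an elementary summand. -/
lemma exists_ladderSummand {V W : PersMod F T} {d : T} {ι κ : Type} [Fintype ι] [Fintype κ]
    {I : ι → Bar T} {J : κ → Bar T} (Φ : V ⟶ (shift d).obj W)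
    (B : BarBasis V fun i => (I i).toSet) (C : BarBasis W fun j => (J j).toSet) {j₀ : κ} {i₀ : ι}
    (h₀ : entry Φ B C j₀ i₀ ≠ 0)
    (hcol : ∀ j, entry Φ B C j i₀ ≠ 0 →
      (J j).birth ≤ (J j₀).birth ∧ (J j).death ≤ (J j₀).death)
    (hrow : ∀ i, entry Φ B C j₀ i ≠ 0 →
      (I i₀).birth ≤ (I i).birth ∧ (I i₀).death ≤ (I i).death) :
    Nonempty (LadderSummand Φ) := by
  obtain ⟨o1, o2, o3⟩ := entry_ne_zero Φ B C h₀
  have hov (j : κ) (hj : entry Φ B C j i₀ ≠ 0) : (J j₀).birth ≤ (J j).death :=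
    o1.trans (entry_ne_zero Φ B C hj).2.1
  have hov' (i : ι) (hi : entry Φ B C j₀ i ≠ 0) : (I i).birth ≤ (I i₀).death := by
    have := (entry_ne_zero Φ B C hi).2.1
    grind
  set c := entry Φ B C j₀ i₀ with hc
  -- The row of the pivot, divided by `c`, becomes the functional dual to `B.e i₀`, and the column
  -- of the pivot, which is the image of `B.e i₀`, becomes the new basis family for `J j₀`. Both are
  -- cut off outside the bar of the pivot.
  let f (t : T) : V.obj t →ₗ[F] F :=
    if t ∈ (I i₀).toSet then c⁻¹ • ∑ i, entry Φ B C j₀ i • B.f i t else 0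
  let g (t : T) : W.obj t :=
    if t ∈ (J j₀).toSet then ∑ j, entry Φ B C j i₀ • C.e j t else 0
  have f_mem {t : T} (ht : t ∈ (I i₀).toSet) (v : V.obj t) :
      f t v = c⁻¹ * ∑ i, entry Φ B C j₀ i * B.f i t v := by
    simp [f, ht]
  have f_not {t : T} (ht : t ∉ (I i₀).toSet) : f t = 0 := if_neg ht
  have g_mem {t : T} (ht : t ∈ (J j₀).toSet) : g t = ∑ j, entry Φ B C j i₀ • C.e j t := if_pos ht
  have g_not {t : T} (ht : t ∉ (J j₀).toSet) : g t = 0 := if_neg ht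
  have hfz (t : T) (ht : t < (I i₀).birth) (i : ι) (hi : entry Φ B C j₀ i ≠ 0) :
      B.f i t = 0 :=
    (B.isCosection i).zero t fun hm => absurd ((hrow i hi).1.trans hm.1) (not_le.mpr ht)
  have hgz (t : T) (ht : (J j₀).death < t) (j : κ) (hj : entry Φ B C j i₀ ≠ 0) :
      C.e j t = 0 :=
    (C.isSection j).zero t fun hm => absurd (hm.2.trans (hcol j hj).2) (not_le.mpr ht)
  refine ⟨⟨I i₀, J j₀, ⟨?_, ?_, ?_⟩, B.e i₀, f, g, fun t => c⁻¹ • C.f j₀ t, B.isSection i₀,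
    ⟨fun t ht => f_not ht, ?_⟩, ⟨fun t ht => g_not ht, ?_⟩, ⟨?_, ?_⟩, ?_, ?_, ?_, ?_⟩⟩
  · simp only [Bar.translate]; grind
  · simp only [Bar.translate]; grind
  · simp only [Bar.translate]; grind
  -- The cut-off is compatible with inner maps by `hrow`: the bars in the row are born no earlier
  -- and die no earlier than `I i₀`. For `g` the dual argument uses `hcol`.
  · intro s t hst ht v
    have hsum : ∑ i, entry Φ B C j₀ i * B.f i t (tr V hst v) =
        ∑ i, entry Φ B C j₀ i * B.f i s v := by
      refine Finset.sum_congr rfl fun i _ => ?_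
      by_cases hi : entry Φ B C j₀ i = 0
      · rw [hi, zero_mul, zero_mul]
      by_cases hti : t ∈ (I i).toSet
      · rw [(B.isCosection i).map hst hti]
      · have hti' : t < (I i).birth := by
          by_contra hlt
          exact hti ⟨not_lt.mp hlt, ht.2.trans (hrow i hi).2⟩
        rw [(B.isCosection i).zero t hti, (B.isCosection i).zero s
          fun hm => absurd hm.1 (not_le.mpr (hst.trans_lt hti'))]
        simp
    rw [f_mem ht, hsum]
    by_cases hs : s ∈ (I i₀).toSet
    · rw [f_mem hs]
    · have hs' : s < (I i₀).birth := by
        by_contra hlt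
        exact hs ⟨not_lt.mp hlt, hst.trans ht.2⟩
      rw [f_not hs, LinearMap.zero_apply]
      rw [Finset.sum_eq_zero, mul_zero]
      intro i _
      by_cases hi : entry Φ B C j₀ i = 0
      · rw [hi, zero_mul]
      · rw [hfz s hs' i hi]
        simp
  · intro s t hst hs
    rw [g_mem hs, map_sum]
    have hsum : ∑ j, tr W hst (entry Φ B C j i₀ • C.e j s) =
        ∑ j, entry Φ B C j i₀ • C.e j t := by
      refine Finset.sum_congr rfl fun j _ => ?_
      rw [map_smul]
      by_cases hj : entry Φ B C j i₀ = 0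
      · rw [hj, zero_smul, zero_smul]
      by_cases hsj : s ∈ (J j).toSet
      · rw [(C.isSection j).map hst hsj]
      · have hsj' : (J j).death < s := by
          by_contra hlt
          exact hsj ⟨(hcol j hj).1.trans hs.1, not_lt.mp hlt⟩
        rw [(C.isSection j).zero s hsj, (C.isSection j).zero t
          fun hm => absurd hm.2 (not_le.mpr (hsj'.trans_le hst)), map_zero]
    rw [hsum]
    by_cases ht : t ∈ (J j₀).toSet
    · rw [g_mem ht]
    · have ht' : (J j₀).death < t := by
        by_contra hlt
        exact ht ⟨hs.1.trans hst, not_lt.mp hlt⟩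
      rw [g_not ht]
      refine Finset.sum_eq_zero fun j _ => ?_
      by_cases hj : entry Φ B C j i₀ = 0
      · rw [hj, zero_smul]
      · rw [hgz t ht' j hj, smul_zero]
  · intro t ht
    rw [(C.isCosection j₀).zero t ht, smul_zero]
  · intro s t hst ht v
    simp only [LinearMap.smul_apply]
    rw [(C.isCosection j₀).map hst ht]
  · intro t ht
    rw [f_mem ht, Finset.sum_eq_single i₀, B.self i₀ t ht, mul_one, inv_mul_cancel₀ h₀]
    · intro i _ hi
      rw [B.ne i i₀ hi, mul_zero]
    · simp
  · intro t ht
    rw [g_mem ht, LinearMap.smul_apply, map_sum, Finset.sum_eq_single j₀, map_smul, C.self j₀ t ht,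
      smul_eq_mul, smul_eq_mul, mul_one, inv_mul_cancel₀ h₀]
    · intro j _ hj
      rw [map_smul, C.ne j₀ j hj.symm, smul_zero]
    · simp
  · intro t ht
    have hsum : ap Φ t (B.e i₀ t) = ∑ j, entry Φ B C j i₀ • C.e j (t + d) := by
      conv_lhs => rw [← C.total (t + d) (ap Φ t (B.e i₀ t))]
      refine Finset.sum_congr rfl fun j _ => ?_
      by_cases hj : t + d ∈ (J j).toSet
      · rw [entry_eq Φ B C ht hj]
      · rw [(C.isSection j).zero _ hj, smul_zero, smul_zero]
    rw [hsum]
    by_cases hm : t + d ∈ (J j₀).toSet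
    · rw [g_mem hm]
    · have ht' : (J j₀).death < t + d := by
        by_contra hlt
        exact hm ⟨o1.trans (add_le_add_left ht.1 d), not_lt.mp hlt⟩
      rw [g_not hm]
      refine Finset.sum_eq_zero fun j _ => ?_
      by_cases hj : entry Φ B C j i₀ = 0
      · rw [hj, zero_smul]
      · rw [hgz _ ht' j hj, smul_zero]
  · intro t ht v
    have hsum : C.f j₀ (t + d) (ap Φ t v) = ∑ i, entry Φ B C j₀ i * B.f i t v := by
      conv_lhs => rw [← B.total t v, map_sum, map_sum]
      refine Finset.sum_congr rfl fun i _ => ?_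
      rw [map_smul, map_smul, smul_eq_mul, mul_comm]
      by_cases hi : t ∈ (I i).toSet
      · rw [entry_eq Φ B C hi ht]
      · rw [(B.isCosection i).zero t hi]
        simp
    rw [LinearMap.smul_apply, smul_eq_mul, hsum]
    by_cases hm : t ∈ (I i₀).toSet
    · rw [f_mem hm]
    · have ht' : t < (I i₀).birth := by
        by_contra hlt
        refine hm ⟨not_lt.mp hlt, ?_⟩
        have := ht.2
        grind
      rw [f_not hm, LinearMap.zero_apply, Finset.sum_eq_zero, mul_zero]
      intro i _
      by_cases hi : entry Φ B C j₀ i = 0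
      · rw [hi, zero_mul]
      · rw [hfz t ht' i hi]
        simp

/-! ### Complements of an elementary ladder -/

namespace LadderSummand

variable {V W : PersMod F T} {d : T} {Φ : V ⟶ (shift d).obj W} (R : LadderSummand Φ)

lemma map_ker {t : T} {v : V.obj t} (hv : R.f t v = 0) : R.h (t + d) (ap Φ t v) = 0 := by
  by_cases ht : t + d ∈ R.J.toSet
  · rw [R.map_f t ht, hv]
  · simp [R.hh.zero _ ht]

/-- The restriction of `Φ` to the complements. -/
noncomputable def restrict : kerMod V R.hf ⟶ (shift d).obj (kerMod W R.hh) where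
  app t := ModuleCat.ofHom (X := LinearMap.ker (R.f t)) (Y := LinearMap.ker (R.h (t + d)))
    ((ap Φ t).restrict (p := LinearMap.ker (R.f t)) (q := LinearMap.ker (R.h (t + d)))
      (fun _ hv => R.map_ker hv))
  naturality s t h := by
    refine ModuleCat.hom_ext (LinearMap.ext fun v => Subtype.ext ?_)
    exact ap_tr Φ (leOfHom h) v.1

/-- The compression to the complements of a morphism in the other direction. -/
noncomputable def compress (Ψ : W ⟶ (shift d).obj V) :
    kerMod W R.hh ⟶ (shift d).obj (kerMod V R.hf) :=
  kerIncl W R.hh ≫ Ψ ≫ (shift d).map (kerRetr V R.he R.hf R.fe)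

/-- Only the compression of `Ψ` could spoil the relations. On the `V` side, `f` already vanishes on
inner images of its kernel. On the `W` side, the correction term is a multiple of the image of `e`,
and it is zero. -/
lemma interleaved {hd : 0 ≤ d} {Ψ : W ⟶ (shift d).obj V} (h : Interleaved hd Φ Ψ) :
    Interleaved hd R.restrict (R.compress Ψ) := by
  constructor
  · intro t v
    refine Subtype.ext ?_
    change ap Ψ (t + d) (ap Φ t v.1) - R.f _ (ap Ψ (t + d) (ap Φ t v.1)) • R.e _ =
      tr V (le_add_add hd t) v.1
    rw [h.1, R.hf.tr_mem_ker _ v.2, zero_smul, sub_zero]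
  · intro t w
    refine Subtype.ext ?_
    change ap Φ (t + d) (ap Ψ t w.1 - R.f (t + d) (ap Ψ t w.1) • R.e (t + d)) =
      tr W (le_add_add hd t) w.1
    rw [map_sub, map_smul, h.2, sub_eq_self]
    by_cases h1 : t + d ∈ R.I.toSet
    · rw [R.map_e _ h1]
      by_cases h2 : t + d + d ∈ R.J.toSet
      -- The coefficient of the correction is `f (Ψ w) = h (Φ (Ψ w))`, the value of `h` on an inner
      -- image of `w ∈ ker h`.
      · rw [← R.map_f _ h2, h.2, R.hh.tr_mem_ker _ w.2, zero_smul]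
      · rw [R.hg.zero _ h2, smul_zero]
    · rw [R.hf.zero _ h1, LinearMap.zero_apply, zero_smul]

/-- Adjoins the summand to a ladder decomposition of the restriction to the complements. -/
noncomputable def cons {ι : Type} [Fintype ι] {E : ι → ElemLadder T}
    (L : LadderBasis R.restrict E) :
    LadderBasis Φ (fun o : Option ι => o.elim (.R R.I (R.J.translate (-d)) R.overlaps) E) where
  src := BarBasis.cons (S := fun o : Option ι =>
    optSet (o.elim (.R R.I (R.J.translate (-d)) R.overlaps) E : ElemLadder T).srcBar)
    R.he R.hf R.fe L.src
  tgt := BarBasis.cons (V := (shift d).obj W) (S := fun o : Option ι =>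
    optSet (o.elim (.R R.I (R.J.translate (-d)) R.overlaps) E : ElemLadder T).tgtBar)
    (e := fun t => R.g (t + d)) (f := fun t => R.h (t + d))
    (R.hg.shift_bar d) (R.hh.shift_bar d)
    (fun t ht => R.hg' _ ((Bar.preimage_add R.J d).symm ▸ ht : t ∈ (fun t => t + d) ⁻¹' R.J.toSet))
    L.tgt
  map o := match o with
    | none => R.map_e
    | some i => fun t ht => congrArg Subtype.val (L.map i t ht)

end LadderSummand

/-- A ladder decomposition of a zero morphism. -/
noncomputable def LadderBasis.ofZero {X Y : PersMod F T} {Φ : X ⟶ Y}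
    (hΦ : ∀ t v, (Φ.app t).hom v = 0) {ι κ : Type} [Fintype ι] [Fintype κ]
    {I : ι → Bar T} {J : κ → Bar T} (B : BarBasis X fun i => (I i).toSet)
    (C : BarBasis Y fun j => (J j).toSet) :
    LadderBasis Φ (Sum.elim (fun i => .plus (I i)) (fun j => .minus (J j))) where
  src :=
    { e := fun a t => match a with
        | .inl i => B.e i t
        | .inr _ => 0
      f := fun a t => match a with
        | .inl i => B.f i t
        | .inr _ => 0
      isSection := fun a => match a with
        | .inl i => B.isSection i
        | .inr _ => ⟨fun _ _ => rfl, fun _ _ => map_zero _⟩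
      isCosection := fun a => match a with
        | .inl i => B.isCosection i
        | .inr _ => ⟨fun _ _ => rfl, fun _ _ _ => rfl⟩
      self := fun a => match a with
        | .inl i => B.self i
        | .inr _ => fun t ht => absurd ht (Set.notMem_empty t)
      ne := fun a b h t => match a, b, h with
        | .inl i, .inl j, h => B.ne i j (fun h' => h (congrArg _ h')) t
        | .inl i, .inr _, _ => map_zero (B.f i t)
        | .inr _, _, _ => rfl
      total := fun t v => by
        rw [Fintype.sum_sum_type]
        simpa using B.total t v }
  tgt :=
    { e := fun a t => match a with
        | .inl _ => 0
        | .inr j => C.e j t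
      f := fun a t => match a with
        | .inl _ => 0
        | .inr j => C.f j t
      isSection := fun a => match a with
        | .inl _ => ⟨fun _ _ => rfl, fun _ _ => map_zero _⟩
        | .inr j => C.isSection j
      isCosection := fun a => match a with
        | .inl _ => ⟨fun _ _ => rfl, fun _ _ _ => rfl⟩
        | .inr j => C.isCosection j
      self := fun a => match a with
        | .inl _ => fun t ht => absurd ht (Set.notMem_empty t)
        | .inr j => C.self j
      ne := fun a b h t => match a, b, h with
        | .inr i, .inr j, h => C.ne i j (fun h' => h (congrArg _ h')) t
        | .inr i, .inl _, _ => map_zero (C.f i t)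
        | .inl _, _, _ => rfl
      total := fun t v => by
        rw [Fintype.sum_sum_type]
        simpa using C.total t v }
  map a := match a with
    | .inl i => fun t _ => hΦ t _
    | .inr _ => fun t ht => absurd ht (Set.notMem_empty t)

/-! ### Existence of ladder decompositions -/

/-- Strictly nested bars of `V` differ by more than `r` at both endpoints. -/
def SeparatedBars (r : T) (V : PersMod F T) : Prop :=
  ∀ I ∈ barcode V, ∀ J ∈ barcode V, I.StrictlyNested J →
    r < I.birth - J.birth ∧ r < J.death - I.death

lemma SeparatedBars.separated {r : T} {V : PersMod F T} (h : SeparatedBars r V) {ι : Type}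
    [Fintype ι] {I : ι → Bar T} (B : BarBasis V fun i => (I i).toSet) : Separated r I :=
  fun i i' => h _ (B.mem_barcode i) _ (B.mem_barcode i')

lemma univ_map_eq_sum {α ι : Type} [Fintype ι] (I : ι → α) :
    Finset.univ.val.map I = ∑ i, ({I i} : Multiset α) := by
  rw [Finset.sum, ← Multiset.sum_map_singleton (Finset.univ.val.map I), Multiset.map_map]
  rfl

/-- Provides both what decreases in the induction and what is inherited: the bars of a complement
are bars of `V`, so separation persists. -/
lemma FinitelyIndexed.barcode_ker {V : PersMod F T} (hV : FinitelyIndexed V) {I : Bar T}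
    {e : ∀ t, V.obj t} {f : ∀ t, V.obj t →ₗ[F] F} (he : IsSection V I.toSet e)
    (hf : IsCosection V I.toSet f) (h1 : ∀ t ∈ I.toSet, f t (e t) = 1) :
    FinitelyIndexed (kerMod V hf) ∧ barcode V = I ::ₘ barcode (kerMod V hf) := by
  have hK := hV.retract (kerIncl_retr he hf h1)
  refine ⟨hK, ?_⟩
  obtain ⟨ι, _, J, ⟨B⟩⟩ := hK.exists_barBasis
  rw [B.barcode_eq, (BarBasis.cons (S := fun o => (o.elim I J).toSet) he hf h1 B).barcode_eq,
    univ_map_eq_sum, Fintype.sum_option, univ_map_eq_sum]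
  rfl

/-- An interleaving morphism between modules whose strictly nested bars are far from each other has
a ladder decomposition. -/
theorem exists_ladderBasis {V W : PersMod F T} (hV : FinitelyIndexed V) (hW : FinitelyIndexed W)
    {d : T} {hd : 0 ≤ d} {Φ : V ⟶ (shift d).obj W} {Ψ : W ⟶ (shift d).obj V}
    (h : Interleaved hd Φ Ψ) (hsV : SeparatedBars (d + d) V) (hsW : SeparatedBars (d + d) W) :
    ∃ (ι : Type) (_ : Fintype ι) (E : ι → ElemLadder T), Nonempty (LadderBasis Φ E) := by
  induction hn : (barcode V).card using Nat.strong_induction_on generalizing V W with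
  | _ n ih =>
  obtain ⟨ι, _, I, ⟨B⟩⟩ := hV.exists_barBasis
  obtain ⟨κ, _, J, ⟨C⟩⟩ := hW.exists_barBasis
  -- If the matrix is zero, so is `Φ`, and each bar forms an elementary ladder by itself.
  by_cases h0 : ∀ j i, entry Φ B C j i = 0
  · obtain ⟨C'⟩ := C.exists_shift d
    exact ⟨ι ⊕ κ, inferInstance, _, ⟨LadderBasis.ofZero (ap_eq_zero Φ B C h0) B C'⟩⟩
  push Not at h0
  obtain ⟨j₀, i₀, h₀, hcol, hrow⟩ := exists_pivot B C h (hsV.separated B) (hsW.separated C) h0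
  obtain ⟨R⟩ := exists_ladderSummand Φ B C h₀ hcol hrow
  obtain ⟨hV', hbV⟩ := hV.barcode_ker R.he R.hf R.fe
  obtain ⟨hW', hbW⟩ := hW.barcode_ker R.hg R.hh R.hg'
  have hmV {K : Bar T} (hK : K ∈ barcode (kerMod V R.hf)) : K ∈ barcode V := by
    rw [hbV]
    exact Multiset.mem_cons_of_mem hK
  have hmW {K : Bar T} (hK : K ∈ barcode (kerMod W R.hh)) : K ∈ barcode W := by
    rw [hbW]
    exact Multiset.mem_cons_of_mem hK
  obtain ⟨α, _, E, ⟨L⟩⟩ := ih _ (by rw [← hn, hbV, Multiset.card_cons]; exact Nat.lt_succ_self _)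
    hV' hW' (R.interleaved h) (fun I hI J hJ => hsV I (hmV hI) J (hmV hJ))
    (fun I hI J hJ => hsW I (hmW hI) J (hmW hJ)) rfl
  exact ⟨Option α, inferInstance, _, ⟨R.cons L⟩⟩

/-! ### Closeness of matched bars -/

section Cost

variable {V W : PersMod F T} {d : T} {hd : 0 ≤ d} {Φ : V ⟶ (shift d).obj W}
  {Ψ : W ⟶ (shift d).obj V} {ι : Type} [Fintype ι] {E : ι → ElemLadder T}

lemma optSet_mem {a : Option (Bar T)} {I : Bar T} {t : T} (h : a = some I)
    (h1 : I.birth ≤ t) (h2 : t ≤ I.death) : t ∈ optSet a := h ▸ ⟨h1, h2⟩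

namespace LadderBasis

variable (Ψ) in
/-- The matrix entry of `Ψ` that links the target bar of a summand of `Φ` to its source bar. -/
noncomputable def backEntry (L : LadderBasis Φ E) (i : ι) (t : T) : F :=
  L.src.f i (t + d + d) (ap Ψ (t + d) (show W.obj (t + d) from L.tgt.e i t))

lemma backEntry_of_long_source (L : LadderBasis Φ E) (h : Interleaved hd Φ Ψ) {i : ι} {I : Bar T}
    (hI : (E i).srcBar = some I) (hl : I.birth + d + d ≤ I.death) :
    L.backEntry Ψ i I.birth = 1 := by
  have hm : I.birth ∈ optSet (E i).srcBar := optSet_mem hI le_rfl I.le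
  have h1 : ap Φ I.birth (L.src.e i I.birth) = L.tgt.e i I.birth := L.map i _ hm
  have h2 := h.1 I.birth (L.src.e i I.birth)
  rw [h1, (L.src.isSection i).map _ hm] at h2
  exact (congrArg (L.src.f i _) h2).trans
    (L.src.self i _ (optSet_mem hI (le_add_add hd _) hl))

/-- By `map_f`, applying the source functional after `Ψ` equals applying the target functional after
`Φ ∘ Ψ`, which is an inner map that a long target bar survives. -/
lemma backEntry_of_long_target (L : LadderBasis Φ E) (h : Interleaved hd Φ Ψ) {i : ι} {J : Bar T}
    (hJ : (E i).tgtBar = some J) (hl : J.birth + d + d ≤ J.death) :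
    L.backEntry Ψ i J.birth = 1 := by
  have hm : J.birth ∈ optSet (E i).tgtBar := optSet_mem hJ le_rfl J.le
  have hm' : J.birth + d + d ∈ optSet (E i).tgtBar := optSet_mem hJ (le_add_add hd _) hl
  have h2 := h.2 (J.birth + d) (L.tgt.e i J.birth)
  have h3 : tr W (le_add_add hd (J.birth + d)) (show W.obj (J.birth + d) from L.tgt.e i J.birth) =
      L.tgt.e i (J.birth + d + d) :=
    Eq.trans (by rfl) ((L.tgt.isSection i).map (le_add_add hd J.birth) hm)
  have h4 := L.map_f i hm' (ap Ψ (J.birth + d) (show W.obj (J.birth + d) from L.tgt.e i J.birth))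
  rw [backEntry]
  refine h4.symm.trans ?_
  exact (congrArg (L.tgt.f i (J.birth + d + d)) (h2.trans h3)).trans (L.tgt.self i _ hm')

/-- A nonzero back entry is a nonzero morphism from the interval module of the target bar to that of
the source bar shifted by `2d`. In particular neither bar can be missing. -/
lemma le_of_backEntry_ne_zero (L : LadderBasis Φ E) {i : ι} {t : T}
    (h : L.backEntry Ψ i t ≠ 0) : ∃ I J, (E i).srcBar = some I ∧ (E i).tgtBar = some J ∧
      I.birth ≤ J.birth + d + d ∧ I.death ≤ J.death + d + d := by
  have he := (L.tgt.isSection i).comp ((shift d).map Ψ)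
  have hf := ((L.src.isCosection i).shift d).shift d
  obtain ⟨h1, h2⟩ := mem_of_pairing_ne_zero he hf h
  obtain ⟨J, hJ⟩ := exists_of_mem_optSet h1
  obtain ⟨I, hI⟩ := exists_of_mem_optSet h2
  have hs : IsSection ((shift d).obj W) J.toSet (L.tgt.e i) := by
    have := L.tgt.isSection i
    rwa [hJ] at this
  have he' := hs.comp ((shift d).map Ψ)
  have hf' := L.src.isCosection i
  rw [hI] at hf'
  have h3 := le_of_pairing_ne_zero he' (IsCosection.shift_bar (IsCosection.shift_bar hf' d) d) h
  simp only [Bar.translate] at h3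
  exact ⟨I, J, hI, hJ, by grind, by grind⟩

/-- The relation `J ≼ I` bounds the endpoints on one side. The other side comes from the back entry
if one of the two bars is long. -/
lemma close_of_R (L : LadderBasis Φ E) (h : Interleaved hd Φ Ψ) {i : ι} {I J : Bar T} {ho}
    (hi : E i = .R I J ho) : max |(I.birth : ℝ) - (J.translate d).birth|
      |(I.death : ℝ) - (J.translate d).death| ≤ d := by
  have hI : (E i).srcBar = some I := by rw [hi]; rfl
  have hJ : (E i).tgtBar = some J := by rw [hi]; rfl
  obtain ⟨o1, o2, o3⟩ := ho
  have key : I.birth ≤ J.birth + d + d ∧ I.death ≤ J.death + d + d := by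
    have back (t : T) (ht : L.backEntry Ψ i t = 1) :
        I.birth ≤ J.birth + d + d ∧ I.death ≤ J.death + d + d := by
      obtain ⟨I', J', hI', hJ', h1⟩ := L.le_of_backEntry_ne_zero (ht.trans_ne one_ne_zero)
      obtain rfl : I' = I := by simpa [hI'] using hI
      obtain rfl : J' = J := by simpa [hJ'] using hJ
      exact h1
    by_cases h1 : I.birth + d + d ≤ I.death
    · exact back _ (L.backEntry_of_long_source h hI h1)
    by_cases h2 : J.birth + d + d ≤ J.death
    · exact back _ (L.backEntry_of_long_target h hJ h2)
    -- If both bars are shorter than `2d`, their overlap suffices: `I.birth ≤ J.death < J.birth +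
    -- 2d` and `I.death < I.birth + 2d ≤ J.death + 2d`.
    constructor <;> grind
  have k1 : (I.birth : ℝ) ≤ J.birth + d + d := key.1
  have k2 : (I.death : ℝ) ≤ J.death + d + d := key.2
  have k3 : (J.birth : ℝ) ≤ I.birth := o1
  have k4 : (J.death : ℝ) ≤ I.death := o3
  simp only [Bar.translate, AddSubgroup.coe_add]
  refine max_le (abs_le.mpr ⟨?_, ?_⟩) (abs_le.mpr ⟨?_, ?_⟩) <;> linarith

lemma length_lt_of_plus (L : LadderBasis Φ E) (h : Interleaved hd Φ Ψ) {i : ι} {I : Bar T}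
    (hi : E i = .plus I) : I.length < 2 * d := by
  have hI : (E i).srcBar = some I := by rw [hi]; rfl
  by_contra hl
  have hl' : I.birth + d + d ≤ I.death := by
    have : (I.birth : ℝ) + d + d ≤ I.death := by
      rw [Bar.length] at hl
      linarith
    exact_mod_cast this
  obtain ⟨I', J', -, hJ', -⟩ := L.le_of_backEntry_ne_zero
    ((L.backEntry_of_long_source h hI hl').trans_ne one_ne_zero)
  rw [hi] at hJ'
  cases hJ'

lemma length_lt_of_minus (L : LadderBasis Φ E) (h : Interleaved hd Φ Ψ) {i : ι} {J : Bar T}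
    (hi : E i = .minus J) : J.length < 2 * d := by
  have hJ : (E i).tgtBar = some J := by rw [hi]; rfl
  by_contra hl
  have hl' : J.birth + d + d ≤ J.death := by
    have : (J.birth : ℝ) + d + d ≤ J.death := by
      rw [Bar.length] at hl
      linarith
    exact_mod_cast this
  obtain ⟨I', J', hI', -, -⟩ := L.le_of_backEntry_ne_zero
    ((L.backEntry_of_long_target h hJ hl').trans_ne one_ne_zero)
  rw [hi] at hI'
  cases hI'

end LadderBasis

/-- `χ` matches all of `S₁` and `S₂` except for bars of length less than `2 * c`, and moves endpoints
by at most `c`. -/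
def IsCloseMatching (S₁ S₂ : Multiset (Bar T)) (c : ℝ) (χ : Multiset (Bar T × Bar T)) : Prop :=
  (∃ P, S₁ = χ.map Prod.fst + P ∧ ∀ J ∈ P, J.length < 2 * c) ∧
  (∃ Q, S₂ = χ.map Prod.snd + Q ∧ ∀ J ∈ Q, J.length < 2 * c) ∧
  ∀ p ∈ χ, max |(p.1.birth : ℝ) - p.2.birth| |(p.1.death : ℝ) - p.2.death| ≤ c

lemma IsCloseMatching.add {S₁ S₂ : Multiset (Bar T)} {c : ℝ} {χ : Multiset (Bar T × Bar T)}
    (h : IsCloseMatching S₁ S₂ c χ) {P Q : Multiset (Bar T)} (hP : ∀ J ∈ P, J.length < 2 * c)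
    (hQ : ∀ J ∈ Q, J.length < 2 * c) : IsCloseMatching (S₁ + P) (S₂ + Q) c χ := by
  obtain ⟨⟨P', rfl, hP'⟩, ⟨Q', rfl, hQ'⟩, h3⟩ := h
  refine ⟨⟨P' + P, add_assoc _ _ _, fun J hJ => ?_⟩, ⟨Q' + Q, add_assoc _ _ _, fun J hJ => ?_⟩, h3⟩
  · exact (Multiset.mem_add.mp hJ).elim (hP' J) (hP J)
  · exact (Multiset.mem_add.mp hJ).elim (hQ' J) (hQ J)

lemma IsCloseMatching.isPartialMatching {S₁ S₂ : Multiset (Bar T)} {c : ℝ}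
    {χ : Multiset (Bar T × Bar T)} (h : IsCloseMatching S₁ S₂ c χ) :
    IsPartialMatching S₁ S₂ χ := by
  obtain ⟨⟨P', rfl, -⟩, ⟨Q', rfl, -⟩, -⟩ := h
  exact ⟨Multiset.le_add_right _ _, Multiset.le_add_right _ _⟩

lemma fold_max_le {s : Multiset ℝ} {c : ℝ} (hc : 0 ≤ c) (h : ∀ x ∈ s, x ≤ c) :
    s.fold max 0 ≤ c := by
  induction s using Multiset.induction with
  | empty => simpa using hc
  | cons a s ih =>
    rw [Multiset.fold_cons_left]
    exact max_le (h a (Multiset.mem_cons_self a s))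
      (ih fun x hx => h x (Multiset.mem_cons_of_mem hx))

lemma IsCloseMatching.cost_le {S₁ S₂ : Multiset (Bar T)} {c : ℝ} (hc : 0 ≤ c)
    {χ : Multiset (Bar T × Bar T)} (h : IsCloseMatching S₁ S₂ c χ) :
    matchingCost S₁ S₂ χ ≤ c := by
  obtain ⟨⟨P, rfl, hP⟩, ⟨Q, rfl, hQ⟩, h3⟩ := h
  rw [matchingCost, add_tsub_cancel_left, add_tsub_cancel_left]
  refine fold_max_le hc fun x hx => ?_
  rw [Multiset.mem_add, Multiset.mem_map, Multiset.mem_map] at hx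
  rcases hx with ⟨p, hp, rfl⟩ | ⟨J, hJ, rfl⟩
  · exact h3 p hp
  · have : J.length < 2 * c := (Multiset.mem_add.mp hJ).elim (hP J) (hQ J)
    linarith

lemma LadderBasis.isCloseMatching (L : LadderBasis Φ E) (h : Interleaved hd Φ Ψ)
    (hW : FinitelyIndexed W) : IsCloseMatching (barcode V) (barcode W) d
      (matchingOf d (Finset.univ.val.map E)) := by
  refine ⟨⟨(Finset.univ.val.map E).filterMap ElemLadder.plusBar, ?_, ?_⟩,
    ⟨((Finset.univ.val.map E).filterMap ElemLadder.minusBar).map fun J => J.translate d, ?_, ?_⟩,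
    ?_⟩
  · rw [← filterMap_srcBar, L.src.barcode_eq_filterMap, Multiset.filterMap_map,
      Multiset.filterMap_map]
    rfl
  · intro J hJ
    rw [Multiset.filterMap_map, Multiset.mem_filterMap] at hJ
    obtain ⟨i, -, hi⟩ := hJ
    simp only [Function.comp_apply] at hi
    cases hE : E i with
    | R I J h => rw [hE] at hi; cases hi
    | plus I => rw [hE] at hi; cases hi; exact L.length_lt_of_plus h hE
    | minus K => rw [hE] at hi; cases hi
  · rw [← filterMap_tgtBar, ← hW.barcode_shift d, L.tgt.barcode_eq_filterMap,
      Multiset.filterMap_map, Multiset.filterMap_map]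
    rfl
  · intro J hJ
    rw [Multiset.mem_map] at hJ
    obtain ⟨J, hJ, rfl⟩ := hJ
    rw [Multiset.filterMap_map, Multiset.mem_filterMap] at hJ
    obtain ⟨i, -, hi⟩ := hJ
    simp only [Function.comp_apply] at hi
    cases hE : E i with
    | R I J h => rw [hE] at hi; cases hi
    | plus I => rw [hE] at hi; cases hi
    | minus K =>
      rw [hE] at hi
      cases hi
      have := L.length_lt_of_minus h hE
      simpa [Bar.length, Bar.translate] using this
  · intro p hp
    rw [matchingOf, Multiset.filterMap_map, Multiset.mem_filterMap] at hp
    obtain ⟨i, -, hi⟩ := hp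
    simp only [Function.comp_apply] at hi
    cases hE : E i with
    | R I J ho => rw [hE] at hi; cases hi; exact L.close_of_R h hE
    | plus I => rw [hE] at hi; cases hi
    | minus K => rw [hE] at hi; cases hi

end Cost

/-! ### Matchings in opposite directions -/

section Count

variable {V W : PersMod F T} {d : T} {hd : 0 ≤ d} {Φ : V ⟶ (shift d).obj W}
  {Ψ : W ⟶ (shift d).obj V} {ι κ : Type} [Fintype ι] [Fintype κ] {E : ι → ElemLadder T}
  {E' : κ → ElemLadder T}

/-- Here the two bases of `V` at `s + d` come from the source of `Φ` and the target of `Ψ`. A link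
through a summand of `Ψ` forces its target bar to be `I`; its source bar is then squeezed through
the relations for `Ψ ∘ Φ` and `Φ ∘ Ψ`. Two-sided length bounds are needed so that the pairings
survive the inner maps over `2d`. -/
lemma LadderBasis.card_le_symm (L : LadderBasis Φ E) (L' : LadderBasis Ψ E')
    (h : Interleaved hd Φ Ψ) (I J : Bar T) (hI : I.birth + d + d ≤ I.death)
    (hJ : J.birth + d + d ≤ J.death) :
    Nat.card {i // (E i).srcBar = some (I.translate d) ∧ (E i).tgtBar = some J} ≤
      Nat.card {k // (E' k).srcBar = some (J.translate d) ∧ (E' k).tgtBar = some I} := by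
  set s := I.birth with hs
  have hIs : I.birth ∈ I.toSet := I.birth_mem
  have hmI {a : Option (Bar T)} (ha : a = some (I.translate d)) : s + d ∈ optSet a :=
    ha ▸ (I.translate d).birth_mem
  refine card_le_of_pairing (F := F) _ _
    (fun k i => L'.tgt.f k s (show ((shift d).obj V).obj s from L.src.e i (s + d)))
    (fun i k => L.src.f i (s + d) (show V.obj (s + d) from L'.tgt.e k s))
    (fun i hi => ?_) (fun i j hi hj hij => ?_) (fun i j k hi hj h1 h2 => ?_)
  · exact (L'.tgt.sum_pairing (t := s) (L.src.f i (s + d)) (L.src.e i (s + d))).trans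
      (L.src.self i _ (hmI hi.1))
  · exact (L'.tgt.sum_pairing (t := s) (L.src.f i (s + d)) (L.src.e j (s + d))).trans
      (L.src.ne i j hij _)
  · have hsec : IsSection V (I.translate d).toSet (L.src.e j) := by
      have := L.src.isSection j
      rwa [hj.1] at this
    have hcos : IsCosection V (I.translate d).toSet (L.src.f i) := by
      have := L.src.isCosection i
      rwa [hi.1] at this
    replace hsec := hsec.shift_bar d
    replace hcos := hcos.shift_bar d
    rw [Bar.translate_translate I (add_neg_cancel d)] at hsec hcos
    have hk : (E' k).tgtBar = some I := by
      obtain ⟨A, B, hA, hB, h3⟩ := le_of_pairing_ne_zero_opt (I := some I) hsec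
        (L'.tgt.isCosection k) h1
      obtain ⟨B', A', hB', hA', h4⟩ := le_of_pairing_ne_zero_opt (J := some I)
        (L'.tgt.isSection k) hcos h2
      cases hA
      cases hA'
      obtain rfl : B' = B := by simpa [hB] using hB'.symm
      rw [hB, Bar.ext (le_antisymm h3.1 h4.1) (le_antisymm h3.2 h4.2)]
    refine ⟨?_, hk⟩
    -- The source bar of the summand of `Ψ` ends and begins no later than `J(d)`.
    have hm : s + d + d ∈ optSet (E' k).tgtBar := optSet_mem hk (le_add_add hd s) hI
    have e1 : L'.src.f k (s + d + d) (show W.obj (s + d + d) from L.tgt.e j (s + d)) ≠ 0 := by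
      have h3 : ap Φ (s + d) (L.src.e j (s + d)) = L.tgt.e j (s + d) := L.map j _ (hmI hj.1)
      have h4 := L'.map_f k hm (ap Φ (s + d) (L.src.e j (s + d)))
      have h5 := congrArg (L'.tgt.f k (s + d + d)) (h.1 (s + d) (L.src.e j (s + d)))
      have h6 := (L'.tgt.isCosection k).map (le_add_add hd s) hm (L.src.e j (s + d))
      rw [h3] at h4
      intro h0
      refine h1 (h6.symm.trans (h5.symm.trans ?_))
      rw [h3]
      exact h4.trans h0
    have hmk := (mem_of_pairing_ne_zero (L.tgt.isSection j) ((L'.src.isCosection k).shift d) e1).2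
    obtain ⟨K, hK⟩ := exists_of_mem_optSet hmk
    have hcosK : IsCosection W K.toSet (L'.src.f k) := by
      have := L'.src.isCosection k
      rwa [hK] at this
    have hsecK : IsSection W K.toSet (L'.src.e k) := by
      have := L'.src.isSection k
      rwa [hK] at this
    have hsecJ : IsSection ((shift d).obj W) J.toSet (L.tgt.e j) := by
      have := L.tgt.isSection j
      rwa [hj.2] at this
    have hcosJ : IsCosection ((shift d).obj W) J.toSet (L.tgt.f i) := by
      have := L.tgt.isCosection i
      rwa [hi.2] at this
    have hsecI : IsSection ((shift d).obj V) I.toSet (L'.tgt.e k) := by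
      have := L'.tgt.isSection k
      rwa [hk] at this
    have l1 := le_of_pairing_ne_zero hsecJ (hcosK.shift_bar d) e1
    obtain ⟨⟨p1, p2, p3⟩, -⟩ := LadderBasis.overlaps_of_eq hi.1 hi.2
    obtain ⟨⟨q1, q2, q3⟩, -⟩ := LadderBasis.overlaps_of_eq hK hk
    simp only [Bar.translate] at l1 p1 p2 p3
    have hr : K.birth ∈ I.toSet := ⟨q1, q2⟩
    -- The length of `J` enters here: `K.birth + d ≤ J.birth + 2d ≤ J.death`, by the first
    -- comparison `l1`.
    have hm' : K.birth + d ∈ optSet (E i).tgtBar := optSet_mem hi.2 (by grind) (by grind)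
    -- The link `h2`, moved from `I.birth` to `K.birth`, is carried to the target of `Φ`. It yields
    -- the opposite comparison of `J` with `K`.
    have e2 : L.tgt.f i (K.birth + d)
        (show W.obj (K.birth + d + d) from L'.src.e k (K.birth + d + d)) ≠ 0 := by
      have h3 := pairing_eq hsecI hcos q1 hIs hr
      have h4 : ap Ψ K.birth (L'.src.e k K.birth) = L'.tgt.e k K.birth :=
        L'.map k _ (optSet_mem hK le_rfl K.le)
      have h5 := L.map_f i hm' (ap Ψ K.birth (L'.src.e k K.birth))
      have h6 := congrArg (L.tgt.f i (K.birth + d)) (h.2 K.birth (L'.src.e k K.birth))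
      rw [hsecK.map _ K.birth_mem] at h6
      intro h0
      refine h2 (h3.symm.trans ?_)
      rw [h4] at h5 h6
      exact h5.symm.trans (h6.trans h0)
    have l2 := le_of_pairing_ne_zero (hsecK.shift_bar d) hcosJ e2
    simp only [Bar.translate] at l2
    rw [hK]
    refine congrArg some (Bar.ext ?_ ?_) <;> simp only [Bar.translate] <;> grind

lemma LadderBasis.count_eq (L : LadderBasis Φ E) (L' : LadderBasis Ψ E')
    (h : Interleaved hd Φ Ψ) (I J : Bar T) (hI : 2 * (d : ℝ) ≤ I.length)
    (hJ : 2 * (d : ℝ) ≤ J.length) :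
    (matchingOf d (Finset.univ.val.map E)).count (I, J) =
      (matchingOf d (Finset.univ.val.map E')).count (J, I) := by
  have long (K : Bar T) (hK : 2 * (d : ℝ) ≤ K.length) :
      (K.translate (-d)).birth + d + d ≤ (K.translate (-d)).death := by
    have : (K.birth : ℝ) + d + d ≤ K.death := by
      rw [Bar.length] at hK
      linarith
    have : K.birth + d + d ≤ K.death := by exact_mod_cast this
    simp only [Bar.translate]
    grind
  have hI' := long I hI
  have hJ' := long J hJ
  rw [← Bar.translate_translate I (neg_add_cancel d),
    ← Bar.translate_translate J (neg_add_cancel d), count_matchingOf, count_matchingOf]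
  exact le_antisymm (L.card_le_symm L' h _ _ hI' hJ') (L'.card_le_symm L h.symm _ _ hJ' hI')

end Count

/-- The matchings induced by an interleaving pair. -/
theorem exists_inverse_matchings {V W : PersMod F T} (hV : FinitelyIndexed V)
    (hW : FinitelyIndexed W) {d : T} {hd : 0 ≤ d} {Φ : V ⟶ (shift d).obj W}
    {Ψ : W ⟶ (shift d).obj V} (h : Interleaved hd Φ Ψ) (hsV : SeparatedBars (d + d) V)
    (hsW : SeparatedBars (d + d) W) :
    ∃ χ χ' : Multiset (Bar T × Bar T), InducesMatching d Φ χ ∧ InducesMatching d Ψ χ' ∧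
      IsCloseMatching (barcode V) (barcode W) d χ ∧ IsCloseMatching (barcode W) (barcode V) d χ' ∧
      ∀ I J : Bar T, 2 * (d : ℝ) ≤ I.length → 2 * (d : ℝ) ≤ J.length →
        χ.count (I, J) = χ'.count (J, I) := by
  obtain ⟨ι, _, E, ⟨L⟩⟩ := exists_ladderBasis hV hW h hsV hsW
  obtain ⟨κ, _, E', ⟨L'⟩⟩ := exists_ladderBasis hW hV h.symm hsW hsV
  exact ⟨_, _, L.inducesMatching, L'.inducesMatching, L.isCloseMatching h hW,
    L'.isCloseMatching h.symm hV, L.count_eq L' h⟩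

/-! ### Splittings -/

/-- The inner maps over distances that exceed all lengths of bars vanish. -/
lemma FinitelyIndexed.tr_eq_zero {V : PersMod F T} (hV : FinitelyIndexed V) {q : ℝ}
    (hq : ∀ J ∈ barcode V, J.length < q) {s t : T} (hst : s ≤ t) (hl : (s : ℝ) + q ≤ t)
    (v : V.obj s) : tr V hst v = 0 := by
  obtain ⟨ι, _, J, ⟨B⟩⟩ := hV.exists_barBasis
  rw [← B.total s v, map_sum]
  refine Finset.sum_eq_zero fun i _ => ?_
  rw [map_smul]
  by_cases hs : s ∈ (J i).toSet
  · rw [(B.isSection i).map hst hs, (B.isSection i).zero, smul_zero]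
    intro ht
    have h1 := hq _ (B.mem_barcode i)
    have h2 : ((J i).birth : ℝ) ≤ s := hs.1
    have h3 : (t : ℝ) ≤ (J i).death := ht.2
    rw [Bar.length] at h1
    linarith
  · rw [(B.isSection i).zero s hs, map_zero, smul_zero]

namespace QSplitting

variable {q : ℝ} {V : PersMod F T} (S : QSplitting q V)

lemma incl_pr : S.incl ≫ S.pr = 𝟙 S.coarse := by
  simp [incl, pr]

lemma fine_incl_pr : (biprod.inr ≫ S.iso.inv) ≫ S.iso.hom ≫ biprod.snd = 𝟙 S.fine := by
  simp

lemma total : S.pr ≫ S.incl + (S.iso.hom ≫ biprod.snd) ≫ biprod.inr ≫ S.iso.inv = 𝟙 V := by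
  have h : S.pr ≫ S.incl + (S.iso.hom ≫ biprod.snd) ≫ biprod.inr ≫ S.iso.inv =
      S.iso.hom ≫ (biprod.fst ≫ biprod.inl + biprod.snd ≫ biprod.inr) ≫ S.iso.inv := by
    simp only [pr, incl, Preadditive.add_comp, Preadditive.comp_add, Category.assoc]
  rw [h, biprod.total, Category.id_comp, Iso.hom_inv_id]

lemma finitelyIndexed_coarse (hV : FinitelyIndexed V) : FinitelyIndexed S.coarse :=
  hV.retract S.incl_pr

lemma finitelyIndexed_fine (hV : FinitelyIndexed V) : FinitelyIndexed S.fine :=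
  hV.retract S.fine_incl_pr

lemma barcode_eq (hV : FinitelyIndexed V) : barcode V = barcode S.coarse + barcode S.fine := by
  obtain ⟨ι, _, I, ⟨B⟩⟩ := (S.finitelyIndexed_coarse hV).exists_barBasis
  obtain ⟨κ, _, J, ⟨C⟩⟩ := (S.finitelyIndexed_fine hV).exists_barBasis
  have D : BarBasis V (fun a : ι ⊕ κ => (Sum.elim I J a).toSet) :=
    BarBasis.sum (S := fun a : ι ⊕ κ => (Sum.elim I J a).toSet) B C S.incl S.pr
      (biprod.inr ≫ S.iso.inv) (S.iso.hom ≫ biprod.snd) S.incl_pr (by simp [incl]) (by simp [pr])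
      S.fine_incl_pr S.total
  rw [D.barcode_eq, B.barcode_eq, C.barcode_eq, univ_map_eq_sum, univ_map_eq_sum, univ_map_eq_sum,
    Fintype.sum_sum_type]
  rfl

/-- The coarse part determines the inner maps over distances at least `q`. -/
lemma tr_incl_pr (hV : FinitelyIndexed V) {s t : T} (hst : s ≤ t) (hl : (s : ℝ) + q ≤ t)
    (v : V.obj s) : tr V hst ((S.incl.app s).hom ((S.pr.app s).hom v)) = tr V hst v := by
  have h1 := hom_apply S.total v
  have h2 : tr V hst (((biprod.inr ≫ S.iso.inv).app s).hom
      (((S.iso.hom ≫ biprod.snd).app s).hom v)) = 0 := by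
    rw [← app_tr, (S.finitelyIndexed_fine hV).tr_eq_zero S.length_lt hst hl, map_zero]
  have h3 : (S.incl.app s).hom ((S.pr.app s).hom v) + ((biprod.inr ≫ S.iso.inv).app s).hom
      (((S.iso.hom ≫ biprod.snd).app s).hom v) = v := h1
  have h4 := congrArg (tr V hst) h3
  rwa [map_add, h2, add_zero] at h4

end QSplitting

/-! ### Restriction of interleavings to retracts -/

section Retracts

variable {V W A B : PersMod F T} {δ h : T}

lemma add_le_add_add (hh : 0 ≤ h) (t : T) : t + δ ≤ t + (δ + h) := by grind

/-- Without the idempotent on `W` the composite would be the inner map over `2δ`, followed by one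
over `2h`. The latter is what makes the idempotent harmless. -/
lemma tr_compress (hh : 0 ≤ h) {iV : A ⟶ V} {pV : V ⟶ A} {iW : B ⟶ W} {pW : W ⟶ B}
    (hV : iV ≫ pV = 𝟙 A)
    (hW : ∀ {s t : T} (hst : s ≤ t), s + h + h ≤ t → ∀ w : W.obj s,
      tr W hst ((iW.app s).hom ((pW.app s).hom w)) = tr W hst w)
    {hδ : 0 ≤ δ} {Φ : V ⟶ (shift δ).obj W} {Ψ : W ⟶ (shift δ).obj V}
    (hΦΨ : ∀ t v, ap Ψ (t + δ) (ap Φ t v) = tr V (le_add_add hδ t) v)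
    {Φ' : A ⟶ (shift (δ + h)).obj B} {Ψ' : B ⟶ (shift (δ + h)).obj A}
    (hΦ' : ∀ t a, ap Φ' t a =
      tr B (add_le_add_add hh t) ((pW.app (t + δ)).hom (ap Φ t ((iV.app t).hom a))))
    (hΨ' : ∀ t b, ap Ψ' t b =
      tr A (add_le_add_add hh t) ((pV.app (t + δ)).hom (ap Ψ t ((iW.app t).hom b))))
    (t : T) (a : A.obj t) : ap Ψ' (t + (δ + h)) (ap Φ' t a) =
      tr A (le_add_add (add_nonneg hδ hh) t) a := by
  have l1 : t + δ + δ ≤ t + (δ + h) + (δ + h) := by grind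
  have l2 : t + δ ≤ t + δ + h + h := by grind
  have l3 : t + δ + h + h + δ ≤ t + (δ + h) + (δ + h) := by grind
  -- Naturality of `Ψ` moves the whole spare distance `2h` in front of `Ψ`, where the idempotent
  -- stands; after `hW` it is moved back.
  have key (w : W.obj (t + δ)) : tr V l1 (ap Ψ (t + δ) w) =
      tr V l3 (ap Ψ (t + δ + h + h) (tr W l2 w)) := by
    rw [ap_tr, tr_tr]
  rw [hΨ', hΦ', app_tr iW, ap_tr, app_tr pV, tr_tr, ← app_tr pV, key, hW _ le_rfl, ← key, hΦΨ,
    tr_tr, ← app_tr iV, retract_apply hV]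

/-- An interleaving pair induces an interleaving pair of retracts that determine the inner maps over
distances at least `2 * h`. -/
lemma interleaved_compress (hh : 0 ≤ h) {iV : A ⟶ V} {pV : V ⟶ A} {iW : B ⟶ W} {pW : W ⟶ B}
    (hV : iV ≫ pV = 𝟙 A) (hW : iW ≫ pW = 𝟙 B)
    (hV' : ∀ {s t : T} (hst : s ≤ t), s + h + h ≤ t → ∀ v : V.obj s,
      tr V hst ((iV.app s).hom ((pV.app s).hom v)) = tr V hst v)
    (hW' : ∀ {s t : T} (hst : s ≤ t), s + h + h ≤ t → ∀ w : W.obj s,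
      tr W hst ((iW.app s).hom ((pW.app s).hom w)) = tr W hst w)
    {hδ : 0 ≤ δ} {Φ : V ⟶ (shift δ).obj W} {Ψ : W ⟶ (shift δ).obj V} (hΦΨ : Interleaved hδ Φ Ψ)
    {Φ' : A ⟶ (shift (δ + h)).obj B} {Ψ' : B ⟶ (shift (δ + h)).obj A}
    (hΦ' : ∀ t a, ap Φ' t a =
      tr B (add_le_add_add hh t) ((pW.app (t + δ)).hom (ap Φ t ((iV.app t).hom a))))
    (hΨ' : ∀ t b, ap Ψ' t b =
      tr A (add_le_add_add hh t) ((pV.app (t + δ)).hom (ap Ψ t ((iW.app t).hom b)))) :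
    Interleaved (add_nonneg hδ hh) Φ' Ψ' :=
  ⟨tr_compress hh hV hW' (hδ := hδ) hΦΨ.1 hΦ' hΨ',
    tr_compress hh hW hV' (hδ := hδ) hΦΨ.2 hΨ' hΦ'⟩

lemma ap_comp_phi (hh : 0 ≤ h) {q : ℝ} (S : QSplitting q W) (Φ : V ⟶ (shift δ).obj W) (t : T)
    (v : V.obj t) :
    ap (Φ ≫ (shift δ).map (S.phi h hh) ≫ regroup S.coarse δ h (δ + h) rfl) t v =
      tr S.coarse (add_le_add_add hh t) ((S.pr.app (t + δ)).hom (ap Φ t v)) := by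
  have l1 : t + δ ≤ t + δ + h := by grind
  have l2 : t + δ + h ≤ t + (δ + h) := by grind
  exact tr_tr S.coarse l1 l2 _

lemma ap_phiTilde_comp (hh : 0 ≤ h) {q : ℝ} (S : QSplitting q V) (Φ : V ⟶ (shift δ).obj W) (t : T)
    (a : S.coarse.obj t) :
    ap (S.phiTilde h hh ≫ (shift h).map Φ ≫ regroup W h δ (δ + h) (add_comm h δ)) t a =
      tr W (add_le_add_add hh t) (ap Φ t ((S.incl.app t).hom a)) := by
  have l1 : t ≤ t + h := by grind
  have l2 : t + h + δ ≤ t + (δ + h) := by grind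
  have h1 : ap (S.phiTilde h hh ≫ (shift h).map Φ ≫ regroup W h δ (δ + h) (add_comm h δ)) t a =
      tr W l2 (ap Φ (t + h) ((S.incl.app (t + h)).hom (tr S.coarse l1 a))) := rfl
  rw [h1, app_tr, ap_tr, tr_tr]

end Retracts

/-! ### Nestedness -/

/-- With `h = q/2`, the bound `δ < x/2 - q/2` reads `2(δ + h) < x`. For each nested pair the
extended real `x` is first replaced by a finite upper bound. -/
lemma separatedBars_of_lt {V : PersMod F T} {δ h : T} {q : ℝ} (hq : (h : ℝ) = q / 2) {x : EReal}
    (hx : x ≤ nestedness V)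
    (hlt : ((δ : ℝ) : EReal) < ((1 / 2 : ℝ) : EReal) * x - ((q / 2 : ℝ) : EReal)) :
    SeparatedBars (δ + h + (δ + h)) V := by
  intro I hI J hJ hn
  have h1 : nestedness V ≤
      ((min |(I.birth : ℝ) - J.birth| |(I.death : ℝ) - J.death| : ℝ) : EReal) :=
    (iInf₂_le I hI).trans ((iInf₂_le J hJ).trans (iInf_le _ hn))
  have h2 := hlt.trans_le (EReal.sub_le_sub
    (mul_le_mul_of_nonneg_left (hx.trans h1) (EReal.coe_nonneg.mpr (by norm_num))) le_rfl)
  rw [← EReal.coe_mul, ← EReal.coe_sub, EReal.coe_lt_coe_iff] at h2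
  have n1 : (J.birth : ℝ) < I.birth := hn.1
  have n2 : (I.death : ℝ) < J.death := hn.2
  rw [abs_of_pos (sub_pos.mpr n1), abs_of_neg (sub_neg.mpr n2)] at h2
  have m1 := min_le_left ((I.birth : ℝ) - J.birth) (-((I.death : ℝ) - J.death))
  have m2 := min_le_right ((I.birth : ℝ) - J.birth) (-((I.death : ℝ) - J.death))
  constructor
  · have : ((δ + h + (δ + h) : T) : ℝ) < ((I.birth - J.birth : T) : ℝ) := by
      push_cast
      linarith
    exact_mod_cast this
  · have : ((δ + h + (δ + h) : T) : ℝ) < ((J.death - I.death : T) : ℝ) := by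
      push_cast
      linarith
    exact_mod_cast this

/-- The bars in `P` and `Q` are shorter than `2 * c`, so leaving them unmatched costs less than `c`.
-/
lemma isInversePair {S₁ S₂ P Q : Multiset (Bar T)} {c ℓ : ℝ} (hc : 0 ≤ c) (hℓ : ℓ = 2 * c)
    {χ χ' : Multiset (Bar T × Bar T)} (h : IsCloseMatching S₁ S₂ c χ)
    (h' : IsCloseMatching S₂ S₁ c χ')
    (hcount : ∀ I J : Bar T, 2 * c ≤ I.length → 2 * c ≤ J.length →
      χ.count (I, J) = χ'.count (J, I))
    (hP : ∀ J ∈ P, J.length < 2 * c) (hQ : ∀ J ∈ Q, J.length < 2 * c) :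
    IsInversePairOfMatchings (S₁ + P) (S₂ + Q) c ℓ χ χ' where
  matching := (h.add hP hQ).isPartialMatching
  matching' := (h'.add hQ hP).isPartialMatching
  cost_le := (h.add hP hQ).cost_le hc
  cost_le' := (h'.add hQ hP).cost_le hc
  count_eq J _ K _ hJ hK := hcount J K (hℓ ▸ hJ) (hℓ ▸ hK)

end Proofs

end PersLadder


/-! ### The three compressed interleaving pairs -/

open PersLadder
theorem mainTheorem7 {F : Type*} [Field F] (T : AddSubgroup ℝ)
    (V W : PersMod F T) (hV : FinitelyIndexed V) (hW : FinitelyIndexed W)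
    (δ : T) (hδ : 0 ≤ δ)
    (Φ : V ⟶ (shift δ).obj W) (Ψ : W ⟶ (shift δ).obj V) (hΦΨ : IsInterleaving δ hδ Φ Ψ)
    (q : ℝ) (h : T) (hh : 0 ≤ h) (hq : (h : ℝ) = q / 2)
    (SV : QSplitting q V) (SW : QSplitting q W)
    (hΞ : ((δ : ℝ) : EReal) <
      ((1 / 2 : ℝ) : EReal) * min (nestedness SV.coarse) (nestedness SW.coarse)
        - ((q / 2 : ℝ) : EReal))
    (Φ₁ : V ⟶ (shift (δ + h)).obj SW.coarse)
    (hΦ₁ : Φ₁ = Φ ≫ (shift δ).map (SW.phi h hh) ≫ regroup SW.coarse δ h (δ + h) rfl)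
    (Ψ₁ : SW.coarse ⟶ (shift (δ + h)).obj V)
    (hΨ₁ : Ψ₁ = SW.phiTilde h hh ≫ (shift h).map Ψ ≫ regroup V h δ (δ + h) (add_comm h δ))
    (Φ₂ : SV.coarse ⟶ (shift (δ + h)).obj W)
    (hΦ₂ : Φ₂ = SV.phiTilde h hh ≫ (shift h).map Φ ≫ regroup W h δ (δ + h) (add_comm h δ))
    (Ψ₂ : W ⟶ (shift (δ + h)).obj SV.coarse)
    (hΨ₂ : Ψ₂ = Ψ ≫ (shift δ).map (SV.phi h hh) ≫ regroup SV.coarse δ h (δ + h) rfl)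
    (Φ₃ : SV.coarse ⟶ (shift (δ + h)).obj SW.coarse)
    (hΦ₃ : Φ₃ = SV.incl ≫ Φ ≫ (shift δ).map (SW.phi h hh) ≫
      regroup SW.coarse δ h (δ + h) rfl)
    (Ψ₃ : SW.coarse ⟶ (shift (δ + h)).obj SV.coarse)
    (hΨ₃ : Ψ₃ = SW.incl ≫ Ψ ≫ (shift δ).map (SV.phi h hh) ≫
      regroup SV.coarse δ h (δ + h) rfl) :
    -- the induced pairs are interleaving pairs
    (IsInterleaving (δ + h) (add_nonneg hδ hh) Φ₁ Ψ₁ ∧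
      IsInterleaving (δ + h) (add_nonneg hδ hh) Φ₂ Ψ₂ ∧
      IsInterleaving (δ + h) (add_nonneg hδ hh) Φ₃ Ψ₃) ∧
    -- the pair between `V` and `W_{≥q}`
    (((δ : ℝ) : EReal) < ((1 / 2 : ℝ) : EReal) * min (nestedness V) (nestedness SW.coarse)
        - ((q / 2 : ℝ) : EReal) →
      ∃ χ χ' : Multiset (Bar T × Bar T),
        InducesMatching (δ + h) Φ₁ χ ∧ InducesMatching (δ + h) Ψ₁ χ' ∧
        IsInversePairOfMatchings (barcode V) (barcode W) (δ + q / 2) (2 * δ + q) χ χ' ∧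
        ∀ K ∈ barcode SW.fine, K ∉ χ.map Prod.snd ∧ K ∉ χ'.map Prod.fst) ∧
    -- the pair between `V_{≥q}` and `W`
    (((δ : ℝ) : EReal) < ((1 / 2 : ℝ) : EReal) * min (nestedness SV.coarse) (nestedness W)
        - ((q / 2 : ℝ) : EReal) →
      ∃ χ χ' : Multiset (Bar T × Bar T),
        InducesMatching (δ + h) Φ₂ χ ∧ InducesMatching (δ + h) Ψ₂ χ' ∧
        IsInversePairOfMatchings (barcode V) (barcode W) (δ + q / 2) (2 * δ + q) χ χ' ∧
        ∀ J ∈ barcode SV.fine, J ∉ χ.map Prod.fst ∧ J ∉ χ'.map Prod.snd) ∧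
    -- the pair between `V_{≥q}` and `W_{≥q}`
    (∃ χ χ' : Multiset (Bar T × Bar T),
        InducesMatching (δ + h) Φ₃ χ ∧ InducesMatching (δ + h) Ψ₃ χ' ∧
        IsInversePairOfMatchings (barcode V) (barcode W) (δ + q / 2) (2 * δ + q) χ χ' ∧
        (∀ J ∈ barcode SV.fine, J ∉ χ.map Prod.fst ∧ J ∉ χ'.map Prod.snd) ∧
        ∀ K ∈ barcode SW.fine, K ∉ χ.map Prod.snd ∧ K ∉ χ'.map Prod.fst) := by
  rw [isInterleaving_iff, isInterleaving_iff, isInterleaving_iff]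
  rw [isInterleaving_iff] at hΦΨ
  have hq0 (s t : T) (hst : s + h + h ≤ t) : (s : ℝ) + q ≤ t := by
    have : (s : ℝ) + h + h ≤ t := by exact_mod_cast hst
    linarith
  have hSV {s t : T} (hst : s ≤ t) (hl : s + h + h ≤ t) := SV.tr_incl_pr hV hst (hq0 s t hl)
  have hSW {s t : T} (hst : s ≤ t) (hl : s + h + h ≤ t) := SW.tr_incl_pr hW hst (hq0 s t hl)
  have i₁ : Interleaved (add_nonneg hδ hh) Φ₁ Ψ₁ := by
    -- The module that is not split is a retract of itself, with the trivial idempotent.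
    refine interleaved_compress hh (iV := 𝟙 V) (pV := 𝟙 V) (Category.id_comp _) SW.incl_pr
      (fun _ _ _ => rfl) hSW hΦΨ (fun t v => ?_) (fun t v => ?_)
    · rw [hΦ₁]
      exact ap_comp_phi hh SW Φ t v
    · rw [hΨ₁]
      exact ap_phiTilde_comp hh SW Ψ t v
  have i₂ : Interleaved (add_nonneg hδ hh) Φ₂ Ψ₂ := by
    refine interleaved_compress hh (iW := 𝟙 W) (pW := 𝟙 W) SV.incl_pr (Category.id_comp _)
      hSV (fun _ _ _ => rfl) hΦΨ (fun t v => ?_) (fun t v => ?_)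
    · rw [hΦ₂]
      exact ap_phiTilde_comp hh SV Φ t v
    · rw [hΨ₂]
      exact ap_comp_phi hh SV Ψ t v
  have i₃ : Interleaved (add_nonneg hδ hh) Φ₃ Ψ₃ := by
    refine interleaved_compress hh SV.incl_pr SW.incl_pr hSV hSW hΦΨ (fun t v => ?_)
      (fun t v => ?_)
    · rw [hΦ₃]
      exact ap_comp_phi hh SW Φ t ((SV.incl.app t).hom v)
    · rw [hΨ₃]
      exact ap_comp_phi hh SV Ψ t ((SW.incl.app t).hom v)
  have hVc := SV.finitelyIndexed_coarse hV
  have hWc := SW.finitelyIndexed_coarse hW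
  have hδ' : (0 : ℝ) ≤ δ := by exact_mod_cast hδ
  have hh' : (0 : ℝ) ≤ h := by exact_mod_cast hh
  have hc : (((δ + h : T)) : ℝ) = δ + q / 2 := by
    push_cast
    rw [hq]
  have hc0 : 0 ≤ (δ : ℝ) + q / 2 := by linarith
  have hℓ : 2 * (δ : ℝ) + q = 2 * (δ + q / 2) := by ring
  have hfV (J : Bar T) (hJ : J ∈ barcode SV.fine) : J.length < 2 * ((δ : ℝ) + q / 2) := by
    linarith [SV.length_lt J hJ]
  have hfW (J : Bar T) (hJ : J ∈ barcode SW.fine) : J.length < 2 * ((δ : ℝ) + q / 2) := by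
    linarith [SW.length_lt J hJ]
  have h0 (J : Bar T) (hJ : J ∈ (0 : Multiset (Bar T))) : J.length < 2 * ((δ : ℝ) + q / 2) :=
    absurd hJ (Multiset.notMem_zero J)
  -- A bar of the fine part differs from every bar of the coarse part by its length, so it cannot
  -- occur in a matching whose components are coarse bars.
  have nV (J : Bar T) (hJ : J ∈ barcode SV.fine) (M : Multiset (Bar T))
      (hM : M ≤ barcode SV.coarse) : J ∉ M := fun hm =>
    absurd (SV.le_length J (Multiset.mem_of_le hM hm)) (not_le.mpr (SV.length_lt J hJ))
  have nW (J : Bar T) (hJ : J ∈ barcode SW.fine) (M : Multiset (Bar T))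
      (hM : M ≤ barcode SW.coarse) : J ∉ M := fun hm =>
    absurd (SW.le_length J (Multiset.mem_of_le hM hm)) (not_le.mpr (SW.length_lt J hJ))
  refine ⟨⟨i₁, i₂, i₃⟩, fun hΞ₁ => ?_, fun hΞ₂ => ?_, ?_⟩
  · obtain ⟨χ, χ', h1, h2, h3, h4, h5⟩ := exists_inverse_matchings hV hWc i₁
      (separatedBars_of_lt hq (min_le_left _ _) hΞ₁) (separatedBars_of_lt hq (min_le_right _ _) hΞ₁)
    rw [hc] at h3 h4 h5
    refine ⟨χ, χ', h1, h2, ?_, fun K hK => ⟨nW K hK _ h3.isPartialMatching.2,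
      nW K hK _ h4.isPartialMatching.1⟩⟩
    -- Only `W` is split here: nothing is added to the barcode of `V`, and the fine bars of `W` are
    -- added unmatched.
    have := isInversePair hc0 hℓ h3 h4 h5 h0 hfW
    rwa [add_zero, ← SW.barcode_eq hW] at this
  · obtain ⟨χ, χ', h1, h2, h3, h4, h5⟩ := exists_inverse_matchings hVc hW i₂
      (separatedBars_of_lt hq (min_le_left _ _) hΞ₂) (separatedBars_of_lt hq (min_le_right _ _) hΞ₂)
    rw [hc] at h3 h4 h5
    refine ⟨χ, χ', h1, h2, ?_, fun K hK => ⟨nV K hK _ h3.isPartialMatching.1,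
      nV K hK _ h4.isPartialMatching.2⟩⟩
    have := isInversePair hc0 hℓ h3 h4 h5 hfV h0
    rwa [add_zero, ← SV.barcode_eq hV] at this
  · obtain ⟨χ, χ', h1, h2, h3, h4, h5⟩ := exists_inverse_matchings hVc hWc i₃
      (separatedBars_of_lt hq (min_le_left _ _) hΞ) (separatedBars_of_lt hq (min_le_right _ _) hΞ)
    rw [hc] at h3 h4 h5
    refine ⟨χ, χ', h1, h2, ?_, fun K hK => ⟨nV K hK _ h3.isPartialMatching.1,
      nV K hK _ h4.isPartialMatching.2⟩, fun K hK => ⟨nW K hK _ h3.isPartialMatching.2,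
      nW K hK _ h4.isPartialMatching.1⟩⟩
    have := isInversePair hc0 hℓ h3 h4 h5 hfV hfW
    rwa [← SV.barcode_eq hV, ← SW.barcode_eq hW] at this
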